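/- Let $K$ be a field of characteristic zero (for instance $\mathbb C$), let $r$ be a positive integer and let $W$ be a vector space over $K$. Write $\mathbf x=(x_1,\dots,x_r)$, $\mathbf x^{\mathbf m}=x_1^{m_1}\cdots x_r^{m_r}$, $\mathbf z\mathbf y=(z_1y_1,\dots,z_ry_r)$, and for a vector space $U$ put $$\mathcal E(U,r)=\mathrm{Hom}\big(U,\,U[[x_1^{\pm1},\dots,x_r^{\pm1}]]((x_0))\big)\subset(\mathrm{End}\,U)[[x_0^{\pm1},\dots,x_r^{\pm1}]].$$ Powers of binomials are expanded in nonnegative powers of the second variable, and $\delta(x)=\sum_{n\in\mathbb Z}x^n$. **Toroidal vertex algebras.** An *$(r+1)$-toroidal vertex algebra* is a vector space $V$ with a linear map $Y(\cdot;x_0,\mathbf x):V\to\mathcal E(V,r)$ and a vector $\mathbf 1\in V$ such that $Y(\mathbf 1;x_0,\mathbf x)v=v$ and $Y(v;x_0,\mathbf x)\mathbf 1\in V[[x_0,x_1^{\pm1},\dots,x_r^{\pm1}]]$ for all $v\in V$, and such that the following Jacobi identity holds for all $u,v\in V$: $$z_0^{-1}\delta\Big(\tfrac{x_0-y_0}{z_0}\Big)Y(u;x_0,\mathbf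 z\mathbf y)Y(v;y_0,\mathbf y)-z_0^{-1}\delta\Big(\tfrac{y_0-x_0}{-z_0}\Big)Y(v;y_0,\mathbf y)Y(u;x_0,\mathbf z\mathbf y)=y_0^{-1}\delta\Big(\tfrac{x_0-z_0}{y_0}\Big)Y(Y(u;z_0,\mathbf z)v;y_0,\mathbf y).$$ A *$V$-module* is a vector space $W$ with a linear map $Y_W:V\to\mathcal E(W,r)$ such that $Y_W(\mathbf 1;x_0,\mathbf x)=1_W$ and the same Jacobi identity holds with the outer operators $Y$ replaced by $Y_W$ (and the inner $Y(u;z_0,\mathbf z)v$ unchanged); it is *faithful* if $Y_W$ is injective. An *extended $(r+1)$-toroidal vertex algebra* is an $(r+1)$-toroidal vertex algebra $V$ with linear operators $\mathcal D_0,\dots,\mathcal D_r$ on $V$ such that, for all $v\in V$ and $1\le j\le r$, $\mathcal D_0\mathbf 1=\mathcal D_j\mathbf 1=0$ and $$[\mathcal D_0,Y(v;x_0,\mathbf x)]=Y(\mathcal D_0v;x_0,\mathbf x)=\tfrac{\partial}{\partial x_0}Y(v;x_0,\mathbf x),\qquad [\mathcal D_j,Y(v;x_0,\mathbf x)]=Y(\mathcal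 D_jv;x_0,\mathbf x)=x_j\tfrac{\partial}{\partial x_j}Y(v;x_0,\mathbf x).$$ **Local subspaces.** A subspace $V\subset\mathcal E(W,r)$ is *local* if for all $a,b\in V$ there is an integer $k\ge0$ with $(x_0-y_0)^ka(x_0,\mathbf x)b(y_0,\mathbf y)=(x_0-y_0)^kb(y_0,\mathbf y)a(x_0,\mathbf x)$. In that case $(x_0-y_0)^ka(x_0,\mathbf x)b(y_0,\mathbf y)\in\mathrm{Hom}\big(W,W[[x_1^{\pm1},y_1^{\pm1},\dots,x_r^{\pm1},y_r^{\pm1}]]((x_0,y_0))\big)$, and for any integer $k\ge 0$ with this last property one sets $$Y_{\mathcal E}(a(y_0,\mathbf y);z_0,\mathbf z)b(y_0,\mathbf y)=z_0^{-k}\big((x_0-y_0)^ka(x_0,\mathbf z\mathbf y)b(y_0,\mathbf y)\big)\big|_{x_0=y_0+z_0}=\sum_{(m_0,\mathbf m)\in\mathbb Z\times\mathbb Z^r}a(y_0,\mathbf y)_{m_0,\mathbf m}b(y_0,\mathbf y)\,z_0^{-m_0-1}\mathbf z^{-\mathbf m},$$ with coefficients $a_{m_0,\mathbf m}b\in\mathcal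 E(W,r)$; this does not depend on the choice of $k$. A local subspace $V$ is *closed* if $a_{m_0,\mathbf m}b\in V$ for all $a,b\in V$ and all $(m_0,\mathbf m)\in\mathbb Z\times\mathbb Z^r$. **Theorem 3.4.** Let $V$ be a closed local subspace of $\mathcal E(W,r)$ containing the identity operator $1_W$. Then $(V,Y_{\mathcal E},1_W)$ is an $(r+1)$-toroidal vertex algebra, and $W$ is a faithful $V$-module with $Y_W(a(x_0,\mathbf x);z_0,\mathbf z)=a(z_0,\mathbf z)$ for $a\in V$. If moreover $V$ is stable under $D_0=\partial/\partial x_0$ and $D_i=x_i\,\partial/\partial x_i$ $(1\le i\le r)$, then $V$ is an extended $(r+1)$-toroidal vertex algebra with $\mathcal D_i=D_i$ on $V$ $(0\le i\le r)$. -/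

import Mathlib

noncomputable section

namespace Toroidal

variable {K : Type*} [Field K] {r : ℕ} {V W : Type*}
  [AddCommGroup V] [Module K V] [AddCommGroup W] [Module K W]

/-- The integer `(-1)^i * C(l, i)`, i.e. the coefficient of `x^(l-i) y^i` in `(x - y)^l` (`l : ℤ`),
expanded in nonnegative powers of the second variable `y`. -/
def binomCoeff (l : ℤ) (i : ℕ) : ℤ := (-1) ^ i * Ring.choose l i

variable (K r W) in
/-- `(End W)[[x₀^{±1}, x₁^{±1}, …, x_r^{±1}]]`: the value `a p m` is the coefficient of
`x₀^p x^m`, where `x^m = x₁^{m₁} ⋯ x_r^{m_r}`. -/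
abbrev FormalDist := ℤ → (Fin r → ℤ) → Module.End K W

variable (K r W) in
/-- `ℰ(W, r) = Hom (W, W[[x₁^{±1}, …, x_r^{±1}]]((x₀)))` inside
`(End W)[[x₀^{±1}, …, x_r^{±1}]]`: for every `w` the exponents of `x₀` occurring in `a(x₀, x) w`
are bounded below, uniformly in the exponents of `x₁, …, x_r`. -/
def fieldSpace : Submodule K (FormalDist K r W) where
  carrier := {a | ∀ w : W, ∃ N : ℤ, ∀ p < N, ∀ m, a p m w = 0}
  add_mem' := by
    intro a b ha hb w
    obtain ⟨N, hN⟩ := ha w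
    obtain ⟨M, hM⟩ := hb w
    refine ⟨min N M, fun p hp m => ?_⟩
    simp [hN p (lt_of_lt_of_le hp (min_le_left _ _)) m,
      hM p (lt_of_lt_of_le hp (min_le_right _ _)) m]
  zero_mem' := fun _ => ⟨0, fun _ _ _ => rfl⟩
  smul_mem' := by
    intro c a ha w
    obtain ⟨N, hN⟩ := ha w
    exact ⟨N, fun p hp m => by simp [hN p hp m]⟩

/-- The coefficient of `x₀^p x^m` in a field `a(x₀, x)`. -/
def coeff (a : fieldSpace K r W) (p : ℤ) (m : Fin r → ℤ) : Module.End K W :=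
  (a : FormalDist K r W) p m

variable (K r W) in
/-- The identity operator `1_W`, viewed as the constant series in `ℰ(W, r)`. -/
def idField : fieldSpace K r W :=
  ⟨fun p m => if p = 0 ∧ m = 0 then LinearMap.id else 0, fun _ => ⟨0, fun p hp m => by
    simp [hp.ne]⟩⟩

variable (K r W) in
/-- `D₀ = ∂/∂x₀` acting on `ℰ(W, r)`. -/
def derivZero : Module.End K (fieldSpace K r W) where
  toFun a := ⟨fun p m => (p + 1) • coeff a (p + 1) m, fun w => by
    obtain ⟨N, hN⟩ := a.2 w
    exact ⟨N - 1, fun p hp m => by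
      rw [LinearMap.smul_apply, coeff, hN (p + 1) (by omega) m, smul_zero]⟩⟩
  map_add' a b := by
    ext p m w
    simp [coeff]
  map_smul' c a := by
    ext p m w
    simp only [coeff, Submodule.coe_smul, Pi.smul_apply, LinearMap.smul_apply, RingHom.id_apply]
    rw [smul_comm]

variable (K r W) in
/-- `D_j = x_j ∂/∂x_j` acting on `ℰ(W, r)`, for the `r` variables `x₁, …, x_r`. -/
def eulerDeriv (j : Fin r) : Module.End K (fieldSpace K r W) where
  toFun a := ⟨fun p m => m j • coeff a p m, fun w => by
    obtain ⟨N, hN⟩ := a.2 w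
    exact ⟨N, fun p hp m => by rw [LinearMap.smul_apply, coeff, hN p hp m, smul_zero]⟩⟩
  map_add' a b := by
    ext p m w
    simp [coeff]
  map_smul' c a := by
    ext p m w
    simp only [coeff, Submodule.coe_smul, Pi.smul_apply, LinearMap.smul_apply, RingHom.id_apply]
    rw [smul_comm]

/-- Multiplication by `(x₀ - y₀)^k`, `k` a nonnegative integer: `F p q` is the coefficient of
`x₀^p y₀^q` in the given series. -/
def mulPow {M : Type*} [AddCommGroup M] (k : ℕ) (F : ℤ → ℤ → M) (p q : ℤ) : M :=
  ∑ i ∈ Finset.range (k + 1), binomCoeff k i • F (p - k + i) (q - i)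

/-- `(x₀ - y₀)^k a(x₀, x) b(y₀, y) = (x₀ - y₀)^k b(y₀, y) a(x₀, x)` for some `k ≥ 0`; here the
coefficients of `x^m y^n` are compared for all `m`, `n`. -/
def MutuallyLocal (a b : FormalDist K r W) : Prop :=
  ∃ k : ℕ, ∀ (m n : Fin r → ℤ) (p q : ℤ),
    mulPow k (fun p q => a p m * b q n) p q = mulPow k (fun p q => b q n * a p m) p q

/-- A set of formal distributions is local if any two of its members (possibly equal) are mutually
local. -/
def IsLocalSet (U : Set (FormalDist K r W)) : Prop :=
  ∀ a ∈ U, ∀ b ∈ U, MutuallyLocal a b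

/-- `(x₀ - y₀)^k a(x₀, x) b(y₀, y) ∈ Hom (W, W[[x_i^{±1}, y_i^{±1}]]((x₀, y₀)))`. -/
def CompatibleWith (k : ℕ) (a b : fieldSpace K r W) : Prop :=
  ∀ w : W, ∃ N : ℤ, ∀ (m n : Fin r → ℤ) (p q : ℤ), (p < N ∨ q < N) →
    mulPow k (fun p q => coeff a p m * coeff b q n) p q w = 0

/-- The ordered pair `(a, b)` is compatible. -/
def Compatible (a b : fieldSpace K r W) : Prop := ∃ k : ℕ, CompatibleWith k a b

/-- The coefficient of `x₀^p y₀^q z^m y^n` in `(x₀ - y₀)^k a(x₀, z y) b(y₀, y)`. -/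
def substSeries (k : ℕ) (a b : fieldSpace K r W) (m n : Fin r → ℤ) (p q : ℤ) : Module.End K W :=
  mulPow k (fun p q => coeff a p m * coeff b q (n - m)) p q

/-- For `i ≥ 0`, the coefficient of `z₀^i y₀^s z^m y^n` in
`((x₀ - y₀)^k a(x₀, z y) b(y₀, y)) |_{x₀ = y₀ + z₀} w`, where `x₀^p` is replaced by
`(y₀ + z₀)^p = ∑_{i ≥ 0} C(p, i) y₀^(p-i) z₀^i`.  For compatible `a`, `b` (with the exponent `k`)
the sum over `p` has finitely many nonzero terms. -/
def substCoeff (k : ℕ) (a b : fieldSpace K r W) (m : Fin r → ℤ) (i : ℕ) (s : ℤ) (n : Fin r → ℤ)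
    (w : W) : W :=
  ∑ᶠ p : ℤ, Ring.choose p i • substSeries k a b m n p (s + i - p) w

theorem substCoeff_support {k : ℕ} {a b : fieldSpace K r W} (h : CompatibleWith k a b)
    (m : Fin r → ℤ) (i : ℕ) (s : ℤ) (n : Fin r → ℤ) (w : W) :
    (Function.support
      fun p : ℤ => Ring.choose p i • substSeries k a b m n p (s + i - p) w).Finite := by
  obtain ⟨N, hN⟩ := h w
  refine (Set.finite_Icc N (s + i - N)).subset fun p hp => ?_
  by_contra hc
  apply hp
  have : p < N ∨ s + i - p < N := by
    simp only [Set.mem_Icc, not_and_or, not_le] at hc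
    omega
  simp only [substSeries]
  rw [hN m (n - m) p _ this, smul_zero]

/-- For `i ≥ 0`, the coefficient of `z₀^i z^m` in
`((x₀ - y₀)^k a(x₀, z y) b(y₀, y)) |_{x₀ = y₀ + z₀}`, as an element of `ℰ(W, r)` in the variables
`(y₀, y)`. -/
def substField {k : ℕ} {a b : fieldSpace K r W} (h : CompatibleWith k a b) (m : Fin r → ℤ)
    (i : ℕ) : fieldSpace K r W :=
  ⟨fun s n =>
    { toFun := substCoeff k a b m i s n
      map_add' := fun w w' => by
        simp only [substCoeff, map_add, smul_add]
        exact finsum_add_distrib (substCoeff_support h m i s n w)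
          (substCoeff_support h m i s n w')
      map_smul' := fun c w => by
        simp only [substCoeff, map_smul, RingHom.id_apply]
        rw [smul_finsum' c (substCoeff_support h m i s n w)]
        exact finsum_congr fun p => smul_comm _ _ _ },
    fun w => by
      obtain ⟨N, hN⟩ := h w
      refine ⟨2 * N - i, fun s hs n => ?_⟩
      change substCoeff k a b m i s n w = 0
      refine (finsum_congr fun p => ?_).trans finsum_zero
      simp only [substSeries]
      rw [hN m (n - m) p _ (by omega), smul_zero]⟩

/-- The coefficient of `z₀^t z^m` in
`z₀^{-k} ((x₀ - y₀)^k a(x₀, z y) b(y₀, y)) |_{x₀ = y₀ + z₀}`. -/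
def substShift {k : ℕ} {a b : fieldSpace K r W} (h : CompatibleWith k a b) (t : ℤ)
    (m : Fin r → ℤ) : fieldSpace K r W :=
  if 0 ≤ t + k then substField h m (t + k).toNat else 0

theorem binomCoeff_succ (l : ℤ) (i : ℕ) :
    binomCoeff (l + 1) (i + 1) = binomCoeff l (i + 1) - binomCoeff l i := by
  simp only [binomCoeff, Ring.choose_succ_succ]
  ring

theorem mulPow_succ {M : Type*} [AddCommGroup M] (k : ℕ) (F : ℤ → ℤ → M) (p q : ℤ) :
    mulPow (k + 1) F p q = mulPow k F (p - 1) q - mulPow k F p (q - 1) := by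
  have hz : binomCoeff (k : ℤ) (k + 1) = 0 := by
    simp [binomCoeff, Ring.choose_natCast]
  have h0 : ∀ l : ℤ, binomCoeff l 0 = 1 := fun l => by simp [binomCoeff]
  have e1 : mulPow k F (p - 1) q =
      ∑ i ∈ Finset.range (k + 2), binomCoeff k i • F (p - 1 - k + i) (q - i) := by
    rw [Finset.sum_range_succ, hz, zero_smul, add_zero, mulPow]
  rw [e1, mulPow, mulPow, Finset.sum_range_succ', Finset.sum_range_succ' _ (k + 1),
    add_sub_right_comm, ← Finset.sum_sub_distrib]
  congr 1
  · refine Finset.sum_congr rfl fun i _ => ?_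
    push_cast
    rw [binomCoeff_succ, sub_smul]
    congr 3 <;> ring
  · push_cast
    rw [h0, h0]
    congr 2; ring

theorem CompatibleWith.succ {k : ℕ} {a b : fieldSpace K r W} (h : CompatibleWith k a b) :
    CompatibleWith (k + 1) a b := by
  intro w
  obtain ⟨N, hN⟩ := h w
  refine ⟨N + 0, fun m n p q hpq => ?_⟩
  rw [mulPow_succ, LinearMap.sub_apply, hN m n (p - 1) q (by omega),
    hN m n p (q - 1) (by omega), sub_zero]

theorem substShift_succ {k : ℕ} {a b : fieldSpace K r W} (h : CompatibleWith k a b) (t : ℤ)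
    (m : Fin r → ℤ) : substShift h.succ t m = substShift h t m := by
  have key : ∀ (c : ℤ → ℤ) (s : ℤ) (n : Fin r → ℤ) (w : W),
      ∑ᶠ p : ℤ, c p • substSeries (k + 1) a b m n p (s - p) w =
        ∑ᶠ p : ℤ, (c (p + 1) - c p) • substSeries k a b m n p (s - 1 - p) w := by
    intro c s n w
    obtain ⟨N, hN⟩ := h w
    have fin : ∀ d : ℤ → ℤ, (Function.support fun p : ℤ =>
        d p • substSeries k a b m n p (s - 1 - p) w).Finite := by
      intro d
      refine (Set.finite_Icc N (s - 1 - N)).subset fun p hp => ?_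
      by_contra hc
      apply hp
      simp only [Set.mem_Icc, not_and_or, not_le] at hc
      simp only [substSeries]
      rw [hN m (n - m) p _ (by omega), smul_zero]
    have shift : ∑ᶠ p : ℤ, c p • substSeries k a b m n (p - 1) (s - p) w =
        ∑ᶠ p : ℤ, c (p + 1) • substSeries k a b m n p (s - 1 - p) w := by
      rw [← finsum_comp_equiv (Equiv.addRight (1 : ℤ))]
      refine finsum_congr fun p => ?_
      simp only [Equiv.coe_addRight, add_sub_cancel_right]
      congr 3; ring
    have fin' : (Function.support fun p : ℤ =>
        c p • substSeries k a b m n (p - 1) (s - p) w).Finite := by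
      refine (Set.finite_Icc (N + 1) (s - N)).subset fun p hp => ?_
      by_contra hc
      apply hp
      simp only [Set.mem_Icc, not_and_or, not_le] at hc
      simp only [substSeries]
      rw [hN m (n - m) (p - 1) _ (by omega), smul_zero]
    calc _ = ∑ᶠ p : ℤ, (c p • substSeries k a b m n (p - 1) (s - p) w -
            c p • substSeries k a b m n p (s - 1 - p) w) := by
          refine finsum_congr fun p => ?_
          rw [← smul_sub, ← LinearMap.sub_apply, show s - 1 - p = s - p - 1 by ring]
          simp only [substSeries]
          rw [mulPow_succ]
      _ = _ := by
          rw [finsum_sub_distrib fin' (fin c), shift, ← finsum_sub_distrib (fin _) (fin _)]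
          exact finsum_congr fun p => (sub_smul _ _ _).symm
  rcases lt_trichotomy (t + k + 1) 0 with ht | ht | ht
  · rw [substShift, substShift, if_neg (by push_cast; omega), if_neg (by omega)]
  · rw [substShift, substShift, if_pos (by push_cast; omega), if_neg (by omega)]
    ext s n w
    change substCoeff (k + 1) a b m (t + (k + 1 : ℕ)).toNat s n w = 0
    rw [show (t + (k + 1 : ℕ)).toNat = 0 by push_cast; omega, substCoeff,
      show s + ((0 : ℕ) : ℤ) = s by simp, key]
    simp
  · obtain ⟨i, hi⟩ : ∃ i : ℕ, t + k = i := ⟨(t + k).toNat, by omega⟩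
    rw [substShift, substShift, if_pos (by push_cast; omega), if_pos (by omega),
      show (t + (k + 1 : ℕ)).toNat = i + 1 by push_cast; omega,
      show (t + k).toNat = i by omega]
    ext s n w
    change substCoeff (k + 1) a b m (i + 1) s n w = substCoeff k a b m i s n w
    rw [substCoeff, substCoeff, key]
    refine finsum_congr fun p => ?_
    rw [Ring.choose_succ_succ, add_sub_cancel_right]
    push_cast
    congr 3; ring

/-- The series `z₀^{-k} ((x₀ - y₀)^k a(x₀, z y) b(y₀, y)) |_{x₀ = y₀ + z₀}` does not depend on the
choice of `k`. -/
theorem substShift_indep {k k' : ℕ} {a b : fieldSpace K r W} (h : CompatibleWith k a b)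
    (h' : CompatibleWith k' a b) (t : ℤ) (m : Fin r → ℤ) :
    substShift h t m = substShift h' t m := by
  have up : ∀ {k : ℕ} (h : CompatibleWith k a b) (j : ℕ),
      ∃ g : CompatibleWith (k + j) a b, substShift g t m = substShift h t m := by
    intro k h j
    induction j with
    | zero => exact ⟨h, rfl⟩
    | succ j ih =>
      obtain ⟨g, hg⟩ := ih
      exact ⟨g.succ, (substShift_succ g t m).trans hg⟩
  obtain ⟨g, hg⟩ := up h k'
  obtain ⟨g', hg'⟩ := up h' k
  have e : ∀ {j j' : ℕ} (_ : j = j') (g : CompatibleWith j a b) (g' : CompatibleWith j' a b),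
      substShift g t m = substShift g' t m := by
    rintro j _ rfl g g'
    rfl
  rw [← hg, ← hg', e (Nat.add_comm k k') g g']

open Classical in
/-- The coefficient of `z₀^t z^m` in `Y_ℰ(a(y₀, y); z₀, z) b(y₀, y)`, an element of `ℰ(W, r)`.
It does not depend on the choice of the exponent `k` (`substShift_indep`).  (The value is `0` by convention if
`(a, b)` is not compatible; mutually local pairs in `ℰ(W, r)` are compatible.) -/
def YE (a b : fieldSpace K r W) (t : ℤ) (m : Fin r → ℤ) : fieldSpace K r W :=
  if h : Compatible a b then substShift h.choose_spec t m else 0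

/-- `a(x₀, x)_{m₀, m} b(x₀, x)`, the coefficient of `z₀^{-m₀-1} z^{-m}` in
`Y_ℰ(a(x₀, x); z₀, z) b(x₀, x)`. -/
def modeProduct (a b : fieldSpace K r W) (m₀ : ℤ) (m : Fin r → ℤ) : fieldSpace K r W :=
  YE a b (-m₀ - 1) (-m)

/-- A subspace of `ℰ(W, r)` which is local. -/
def IsLocalSubspace (U : Submodule K (fieldSpace K r W)) : Prop :=
  IsLocalSet (Subtype.val '' (U : Set (fieldSpace K r W)))

/-- Closedness of a (local) subspace under all products `a_{m₀, m} b`. -/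
def IsClosedSubspace (U : Submodule K (fieldSpace K r W)) : Prop :=
  ∀ a ∈ U, ∀ b ∈ U, ∀ (m₀ : ℤ) (m : Fin r → ℤ), modeProduct a b m₀ m ∈ U

/-- The coefficient of `z₀^{-l-1} x₀^p y₀^q z^m y^n` in
`z₀⁻¹ δ((x₀ - y₀)/z₀) A(x₀, z y) B(y₀, y) w`, where
`z₀⁻¹ δ((x₀ - y₀)/z₀) = ∑_{l ∈ ℤ} z₀^{-l-1} (x₀ - y₀)^l`, expanded in nonnegative powers
of `y₀`. The sum is finite. -/
def jacobiTerm₁ (A B : fieldSpace K r W) (w : W) (l p q : ℤ) (m n : Fin r → ℤ) : W :=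
  ∑ᶠ i : ℕ, binomCoeff l i • coeff A (p - l + i) m (coeff B (q - i) (n - m) w)

/-- The coefficient of `z₀^{-l-1} x₀^p y₀^q z^m y^n` in
`z₀⁻¹ δ((y₀ - x₀)/(-z₀)) B(y₀, y) A(x₀, z y) w`, where
`z₀⁻¹ δ((y₀ - x₀)/(-z₀)) = ∑_{l ∈ ℤ} (-1)^l z₀^{-l-1} (y₀ - x₀)^l`, expanded in nonnegative powers
of `x₀`. The sum is finite. -/
def jacobiTerm₂ (A B : fieldSpace K r W) (w : W) (l p q : ℤ) (m n : Fin r → ℤ) : W :=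
  ((Int.negOnePow l : ℤˣ) : ℤ) •
    ∑ᶠ i : ℕ, binomCoeff l i • coeff B (q - l + i) (n - m) (coeff A (p - i) m w)

/-- The coefficient of `z₀^{-l-1} x₀^p y₀^q z^m y^n` in
`y₀⁻¹ δ((x₀ - z₀)/y₀) Y_W(Y(u; z₀, z) v; y₀, y) w`, where
`y₀⁻¹ δ((x₀ - z₀)/y₀) = ∑_{j ∈ ℤ} y₀^{-j-1} (x₀ - z₀)^j`, expanded in nonnegative powers of `z₀`
(so `j = p + i` in the `i`-th term below). The sum is finite. The same series is
`x₀⁻¹ δ((y₀ + z₀)/x₀)`, by `binomCoeff_delta`. -/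
def jacobiTerm₃ (Y : V →ₗ[K] fieldSpace K r V) (YW : V →ₗ[K] fieldSpace K r W) (u v : V) (w : W)
    (l p q : ℤ) (m n : Fin r → ℤ) : W :=
  ∑ᶠ i : ℕ, binomCoeff (p + i) i •
    coeff (YW (coeff (Y u) (-l - 1 - i) m v)) (q + (p + i) + 1) n w

/-- Coefficientwise form of `y₀⁻¹ δ((x₀ - z₀)/y₀) = x₀⁻¹ δ((y₀ + z₀)/x₀)`: both have
the coefficient below at `x₀^p y₀^{-p-i-1} z₀^i`. -/
theorem binomCoeff_delta (p : ℤ) (i : ℕ) :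
    binomCoeff (p + i) i = Ring.choose (-p - 1) i := by
  rw [binomCoeff, show (-p - 1 : ℤ) = -(p + 1) by ring, Ring.choose_neg,
    show (p + 1 + i - 1 : ℤ) = p + i by ring]
  simp [Units.smul_def, Int.negOnePow_def]

/-- The Jacobi identity
`z₀⁻¹ δ((x₀-y₀)/z₀) Y_W(u; x₀, z y) Y_W(v; y₀, y) - z₀⁻¹ δ((y₀-x₀)/(-z₀)) Y_W(v; y₀, y) Y_W(u; x₀, z y)
  = y₀⁻¹ δ((x₀-z₀)/y₀) Y_W(Y(u; z₀, z) v; y₀, y)`,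
as an equality of all coefficients on all vectors. -/
def JacobiIdentity (Y : V →ₗ[K] fieldSpace K r V) (YW : V →ₗ[K] fieldSpace K r W) : Prop :=
  ∀ (u v : V) (w : W) (l p q : ℤ) (m n : Fin r → ℤ),
    jacobiTerm₁ (YW u) (YW v) w l p q m n - jacobiTerm₂ (YW u) (YW v) w l p q m n =
      jacobiTerm₃ Y YW u v w l p q m n

variable (K r V) in
/-- An `(r+1)`-toroidal vertex algebra structure on the vector space `V`. -/
structure ToroidalVertexAlgebra where
  /-- the vertex operator map `v ↦ Y(v; x₀, x)` -/
  Y : V →ₗ[K] fieldSpace K r V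
  /-- the vacuum vector -/
  vac : V
  /-- `Y(1; x₀, x) v = v` -/
  Y_vac : Y vac = idField K r V
  /-- `Y(v; x₀, x) 1 ∈ V[[x₀, x₁^{±1}, …, x_r^{±1}]]` -/
  Y_apply_vac : ∀ (v : V) (p : ℤ) (m : Fin r → ℤ), p < 0 → coeff (Y v) p m vac = 0
  jacobi : JacobiIdentity Y Y

variable (W) in
/-- A module structure on `W` for the `(r+1)`-toroidal vertex algebra `A`. -/
structure ToroidalModule (A : ToroidalVertexAlgebra K r V) where
  /-- the map `v ↦ Y_W(v; x₀, x)` -/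
  Y : V →ₗ[K] fieldSpace K r W
  /-- `Y_W(1; x₀, x) = 1_W` -/
  Y_vac : Y A.vac = idField K r W
  jacobi : JacobiIdentity A.Y Y

/-- A module is faithful if `v ↦ Y_W(v; x₀, x)` is injective. -/
def ToroidalModule.IsFaithful {A : ToroidalVertexAlgebra K r V} (M : ToroidalModule W A) : Prop :=
  Function.Injective M.Y

variable (K r V) in
/-- An extended `(r+1)`-toroidal vertex algebra structure on `V`: an `(r+1)`-toroidal vertex
algebra with linear operators `𝒟₀` and `𝒟₁, …, 𝒟_r`. -/
structure ExtendedToroidalVertexAlgebra extends ToroidalVertexAlgebra K r V where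
  /-- the operator `𝒟₀` -/
  D₀ : Module.End K V
  /-- the operators `𝒟₁, …, 𝒟_r` -/
  D : Fin r → Module.End K V
  D₀_vac : D₀ vac = 0
  D_vac : ∀ j, D j vac = 0
  /-- `[𝒟₀, Y(v; x₀, x)] = Y(𝒟₀ v; x₀, x)` -/
  D₀_comm : ∀ (v : V) (p : ℤ) (m : Fin r → ℤ),
    D₀ * coeff (Y v) p m - coeff (Y v) p m * D₀ = coeff (Y (D₀ v)) p m
  /-- `Y(𝒟₀ v; x₀, x) = ∂/∂x₀ Y(v; x₀, x)` -/
  Y_D₀ : ∀ v : V, Y (D₀ v) = derivZero K r V (Y v)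
  /-- `[𝒟_j, Y(v; x₀, x)] = Y(𝒟_j v; x₀, x)` -/
  D_comm : ∀ (j : Fin r) (v : V) (p : ℤ) (m : Fin r → ℤ),
    D j * coeff (Y v) p m - coeff (Y v) p m * D j = coeff (Y (D j v)) p m
  /-- `Y(𝒟_j v; x₀, x) = x_j ∂/∂x_j Y(v; x₀, x)` -/
  Y_D : ∀ (j : Fin r) (v : V), Y (D j v) = eulerDeriv K r V j (Y v)

end Toroidal

end

open Toroidal

/-!
Fix exponents of the torus variables. The coefficient of `x^m` in `a(x₀, x) ∈ ℰ(W, r)` is an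
ordinary vertex operator in `x₀` (`component`), and locality of `a`, `b` gives one `k` for which
all their components are mutually local of order `k` (`LocalAt`). The exponents `m` add in
products, so every identity of toroidal vertex operators follows from one for ordinary vertex
operators.

*Residue products.* By `coeff_YE`, the components of `Y_ℰ(a; z₀, z) b` are the residue products
`a_(l) b = Res_x ((x - y)^l a(x) b(y) - (-y + x)^l b(y) a(x))`. Indeed `(x - y)^k a(x) b(y)` is
truncated in both variables, the two expansions of `(x - y)^(-i-1)` differ by a divided derivative
of the delta function, and multiplying by this and taking the residue is the substitution
`x = y + z`, read at `z^i` (`expandL_sub_expandR`).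

*Words.* For vertex operators `a`, `b`, `c` the series `a(u₁) b(u₂) c(u₃) w` is a Hahn series with
exponents in `ℤ³`, ordered lexicographically. Hahn series with coefficients in `W` form a vector
space over the field of Hahn series with coefficients in `K`, where `(u₁ - u₂)^l` and the like have
exactly the expansions prescribed by formal calculus (`hcoeff_sub_zpow_smul`). So iterated residue
products are coefficients of rational functions times words (`resProd_right`, `resProd_left`). If a
rational function is `(x - y)^k` times a function regular at `x = y`, it may be applied to
`a(x) b(y)` or to `b(y) a(x)` with the same result (`LocalAt.hcoeff_swapLeft`,
`LocalAt.hcoeff_swapRight`); regularity is encoded by membership in `permSubring`.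

*The Jacobi identity.* Each of its three terms is a finite sum of iterated residue products, and is
a double commutator of `a(x)`, `b(y)`, `c(z)` paired with a truncated Taylor expansion of
`(x - y)^l (x - z)^P (y - z)^Q`: in powers of `y - z` for `[a, [b, c]]`, of `x - z` for
`[b, [a, c]]`, of `x - y` for `[[a, b], c]`. The remainder is a high power of the same difference
times a function regular on its diagonal, so it pairs to zero with the inner commutator. After
replacing the truncations by the function itself, the identity becomes
`[a, [b, c]] - [b, [a, c]] = [[a, b], c]` (`resProd_borcherds`). The module version is the same
argument with two letters (`expandL_sub_expandR_eq_sum_resProd`), and the statements on derivations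
are the Leibniz rule for residue products (`resProd_deriv_left`, `resProd_deriv`).
-/


noncomputable section

namespace Toroidal

/-! ### Finite sums over the natural numbers and the integers -/

section Finsum

theorem finsum_nat_eq_add {M : Type*} [AddCommMonoid M] (f : ℕ → M)
    (hf : (Function.support f).Finite) :
    ∑ᶠ i, f i = f 0 + ∑ᶠ i, f (i + 1) := by
  obtain ⟨N, hN⟩ : ∃ N, ∀ i ≥ N, f i = 0 := by
    obtain ⟨N, hN⟩ := hf.bddAbove
    exact ⟨N + 1, fun i hi => by_contra fun h => by have := hN h; omega⟩
  rw [finsum_eq_sum_of_support_subset (s := Finset.range (N + 1)) f,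
    finsum_eq_sum_of_support_subset (s := Finset.range N), Finset.sum_range_succ', add_comm]
  · intro i hi
    by_contra hc
    simp only [Finset.coe_range, Set.mem_Iio, not_lt] at hc
    exact hi (hN _ (by omega))
  · intro i hi
    by_contra hc
    simp only [Finset.coe_range, Set.mem_Iio, not_lt] at hc
    exact hi (hN _ (by omega))

theorem finsum_int_eq_add {M : Type*} [AddCommMonoid M] (f : ℤ → M)
    (hf : (Function.support f).Finite) :
    ∑ᶠ p : ℤ, f p = ∑ᶠ n : ℕ, f n + ∑ᶠ n : ℕ, f (-1 - n) := by
  have h1 : Function.Injective (fun n : ℕ => (n : ℤ)) := Nat.cast_injective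
  have h2 : Function.Injective (fun n : ℕ => (-1 - n : ℤ)) := fun a b h => by
    simp only at h; omega
  have hu : (Set.univ : Set ℤ) =
      Set.range (fun n : ℕ => (n : ℤ)) ∪ Set.range (fun n : ℕ => (-1 - n : ℤ)) := by
    ext p
    simp only [Set.mem_univ, Set.mem_union, Set.mem_range, true_iff]
    rcases lt_or_ge p 0 with hp | hp
    · exact Or.inr ⟨(-1 - p).toNat, by omega⟩
    · exact Or.inl ⟨p.toNat, by omega⟩
  have hd : Disjoint (Set.range (fun n : ℕ => (n : ℤ)))
      (Set.range (fun n : ℕ => (-1 - n : ℤ))) := by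
    rw [Set.disjoint_left]
    rintro _ ⟨a, rfl⟩ ⟨b, hb⟩
    simp only at hb
    omega
  rw [← finsum_mem_univ, hu, finsum_mem_union' hd (hf.inter_of_right _) (hf.inter_of_right _),
    finsum_mem_range h1, finsum_mem_range h2]

theorem finsum_nat_eq_finsum_add {M : Type*} [AddCommMonoid M] (f : ℕ → M)
    (hf : (Function.support f).Finite) (i : ℕ) (h0 : ∀ n < i, f n = 0) :
    ∑ᶠ n, f n = ∑ᶠ n, f (n + i) := by
  induction i with
  | zero => simp
  | succ i ih =>
    rw [ih fun n hn => h0 n (by omega), finsum_nat_eq_add, zero_add, h0 i (by omega), zero_add]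
    · simp only [add_right_comm, add_assoc]
    · exact hf.preimage (add_left_injective i).injOn

theorem finsum_nat_eq_sum_range {M : Type*} [AddCommMonoid M] (f : ℕ → M) (N : ℕ)
    (hN : ∀ i ≥ N, f i = 0) : ∑ᶠ i, f i = ∑ i ∈ Finset.range N, f i :=
  finsum_eq_sum_of_support_subset f fun i hi => by
    by_contra hc
    simp only [Finset.coe_range, Set.mem_Iio, not_lt] at hc
    exact hi (hN i hc)

end Finsum

/-! ### Hahn series as a module over rational kernels -/

section Hahn

set_option linter.unusedSectionVars false

variable {Γ : Type*} [AddCommGroup Γ] [LinearOrder Γ] [IsOrderedAddMonoid Γ]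
  {K : Type*} [Field K] {W : Type*} [AddCommGroup W] [Module K W]

/-- The coefficient of a `W`-valued Hahn series at the exponent `γ`. -/
def hcoeff (F : HahnModule Γ K W) (γ : Γ) : W := ((HahnModule.of K).symm F).coeff γ

@[simp]
theorem hcoeff_zero (γ : Γ) : hcoeff (0 : HahnModule Γ K W) γ = 0 := rfl

theorem hcoeff_add (F G : HahnModule Γ K W) (γ : Γ) :
    hcoeff (F + G) γ = hcoeff F γ + hcoeff G γ := rfl

theorem hcoeff_sub (F G : HahnModule Γ K W) (γ : Γ) :
    hcoeff (F - G) γ = hcoeff F γ - hcoeff G γ := rfl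

theorem hcoeff_neg (F : HahnModule Γ K W) (γ : Γ) : hcoeff (-F) γ = -hcoeff F γ := rfl

variable (K) in
/-- The monomial with exponent `g` and coefficient `1`. -/
def mono (g : Γ) : HahnSeries Γ K := HahnSeries.single g 1

theorem mono_ne_zero (g : Γ) : mono K g ≠ 0 := by simp [mono]

theorem mono_add (g h : Γ) : mono K (g + h) = mono K g * mono K h := by
  simp [mono]

theorem mono_zero : mono K (0 : Γ) = 1 := rfl

theorem mono_injective : Function.Injective (mono K : Γ → HahnSeries Γ K) := fun g h e => by
  by_contra hne
  have := congrArg (fun f => f.coeff g) e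
  simp [mono, HahnSeries.coeff_single_of_ne hne] at this

theorem mono_zpow (g : Γ) (n : ℤ) : mono K g ^ n = mono K (n • g) := by
  induction n with
  | zero => simp [mono_zero]
  | succ i ih => rw [zpow_add_one₀ (mono_ne_zero g), ih, add_smul, one_smul, mono_add]
  | pred i ih =>
    rw [zpow_sub_one₀ (mono_ne_zero g), ih, mul_inv_eq_iff_eq_mul₀ (mono_ne_zero g), ← mono_add,
      sub_smul, one_smul, sub_add_cancel]

theorem mono_sub_ne_zero {g h : Γ} (hgh : g ≠ h) : mono K g - mono K h ≠ 0 :=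
  sub_ne_zero.2 fun e => hgh (mono_injective e)

theorem hcoeff_mono_smul (g : Γ) (F : HahnModule Γ K W) (γ : Γ) :
    hcoeff (mono K g • F) γ = hcoeff F (γ - g) := by
  have := HahnModule.coeff_single_smul_vadd (r := (1 : K)) (x := F) (a := γ - g) (b := g)
  rw [vadd_eq_add, add_sub_cancel, one_smul] at this
  exact this

theorem hcoeff_mono_sub_smul (g h : Γ) (F : HahnModule Γ K W) (γ : Γ) :
    hcoeff ((mono K g - mono K h) • F) γ = hcoeff F (γ - g) - hcoeff F (γ - h) := by
  rw [sub_smul, hcoeff_sub, hcoeff_mono_smul, hcoeff_mono_smul]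

/-- A well-ordered support meets a strictly decreasing arithmetic progression in finitely many
points. -/
theorem exists_hcoeff_sub_nsmul_eq_zero (F : HahnModule Γ K W) (γ : Γ) {d : Γ} (hd : 0 < d) :
    ∃ N : ℕ, ∀ n ≥ N, hcoeff F (γ - n • d) = 0 := by
  by_contra! hc
  have hf : ∃ᶠ n in Filter.atTop, hcoeff F (γ - n • d) ≠ 0 :=
    Filter.frequently_atTop.2 hc
  obtain ⟨φ, hφ, hP⟩ := Filter.extraction_of_frequently_atTop hf
  obtain ⟨m, n, hmn, hle⟩ := ((HahnModule.of K).symm F).isPWO_support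
    (fun n => ⟨γ - φ n • d, hP n⟩)
  have := nsmul_lt_nsmul_left hd (hφ hmn)
  exact absurd hle (not_le.2 (sub_lt_sub_left this γ))

theorem hcoeff_support_finite (F : HahnModule Γ K W) (γ : Γ) {d : Γ} (hd : 0 < d) (c : ℕ → ℤ) :
    (Function.support fun i : ℕ => c i • hcoeff F (γ - i • d)).Finite := by
  obtain ⟨N, hN⟩ := exists_hcoeff_sub_nsmul_eq_zero F γ hd
  refine (Set.finite_lt_nat N).subset fun i hi => ?_
  by_contra hc
  exact hi (by simp only; rw [hN i (not_lt.1 hc), smul_zero])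

theorem binomCoeff_zero_right (l : ℤ) : binomCoeff l 0 = 1 := by simp [binomCoeff]

theorem binomCoeff_zero_succ (i : ℕ) : binomCoeff 0 (i + 1) = 0 := by simp [binomCoeff]

/-- The binomial theorem for `(x - y)^l`, `l : ℤ`, acting on Hahn series: as `g < h`, the inverse of
`x - y` is expanded in nonnegative powers of `y`. -/
theorem hcoeff_sub_zpow_smul {g h : Γ} (hgh : g < h) (l : ℤ) (F : HahnModule Γ K W) (γ : Γ) :
    hcoeff ((mono K g - mono K h) ^ l • F) γ =
      ∑ᶠ i : ℕ, binomCoeff l i • hcoeff F (γ - l • g - i • (h - g)) := by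
  have hd : 0 < h - g := sub_pos.2 hgh
  have hu := mono_sub_ne_zero (K := K) hgh.ne
  -- Passing from `F` to `(x - y) F` trades `l` for `l + 1`, by Pascal's rule.
  have step : ∀ (l : ℤ) (F : HahnModule Γ K W) (γ : Γ),
      ∑ᶠ i : ℕ, binomCoeff l i •
          hcoeff ((mono K g - mono K h) • F) (γ - l • g - i • (h - g)) =
        ∑ᶠ i : ℕ, binomCoeff (l + 1) i • hcoeff F (γ - (l + 1) • g - i • (h - g)) := by
    intro l F γ
    have e0 : ∀ (i : ℕ) (γ : Γ), γ - (i + 1) • (h - g) = γ - (h - g) - i • (h - g) :=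
      fun i γ => by rw [add_smul, one_smul, sub_sub, add_comm]
    have e : ∀ i : ℕ, hcoeff ((mono K g - mono K h) • F) (γ - l • g - i • (h - g)) =
        hcoeff F (γ - (l + 1) • g - i • (h - g)) -
          hcoeff F (γ - (l + 1) • g - (i + 1) • (h - g)) := by
      intro i
      rw [hcoeff_mono_sub_smul]
      congr 2
      · rw [add_smul, one_smul]; abel
      · rw [add_smul, one_smul, add_smul, one_smul]; abel
    have f1 := hcoeff_support_finite F (γ - (l + 1) • g) hd (binomCoeff l)
    have f2 : (Function.support fun i : ℕ => binomCoeff l i •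
        hcoeff F (γ - (l + 1) • g - (i + 1) • (h - g))).Finite := by
      have := hcoeff_support_finite F (γ - (l + 1) • g - (h - g)) hd (binomCoeff l)
      convert this using 5 with i
      rw [e0]
    have f3 := hcoeff_support_finite F (γ - (l + 1) • g) hd (binomCoeff (l + 1))
    have f4 : (Function.support fun i : ℕ => binomCoeff l (i + 1) •
        hcoeff F (γ - (l + 1) • g - (i + 1) • (h - g))).Finite := by
      have := hcoeff_support_finite F (γ - (l + 1) • g - (h - g)) hd (fun i => binomCoeff l (i + 1))
      convert this using 5 with i
      rw [e0]
    simp only [e]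
    simp only [smul_sub (binomCoeff _ _)]
    rw [finsum_sub_distrib f1 f2, finsum_nat_eq_add _ f1, finsum_nat_eq_add _ f3,
      binomCoeff_zero_right, binomCoeff_zero_right, add_sub_assoc, ← finsum_sub_distrib f4 f2]
    simp only [binomCoeff_succ, sub_smul]
  have main : ∀ (l : ℤ) (F : HahnModule Γ K W), hcoeff ((mono K g - mono K h) ^ l • F) γ =
      ∑ᶠ i : ℕ, binomCoeff l i • hcoeff F (γ - l • g - i • (h - g)) := by
    intro l
    induction l with
    | zero =>
      intro F
      rw [finsum_eq_single _ 0]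
      · simp [binomCoeff_zero_right]
      · rintro (_ | i) hi
        · exact absurd rfl hi
        · rw [binomCoeff_zero_succ, zero_smul]
    | succ i ih =>
      intro F
      rw [zpow_add_one₀ hu, mul_smul, ih, step]
    | pred i ih =>
      intro F
      have hF : F = (mono K g - mono K h) • ((mono K g - mono K h)⁻¹ • F) := by
        rw [← mul_smul, mul_inv_cancel₀ hu, one_smul]
      conv_rhs => rw [hF]
      rw [step, sub_add_cancel, zpow_sub_one₀ hu, mul_smul, ih]
  exact main l F

/-- Multiplication by `(x - y)^k`, `k` a nonnegative integer, where the monomials `x`, `y` are in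
any order. -/
theorem hcoeff_sub_pow_smul (g h : Γ) (k : ℕ) (F : HahnModule Γ K W) (γ : Γ) (p q : ℤ) :
    hcoeff ((mono K g - mono K h) ^ k • F) (γ + p • g + q • h) =
      mulPow k (fun p q => hcoeff F (γ + p • g + q • h)) p q := by
  induction k generalizing p q with
  | zero => simp [mulPow, binomCoeff_zero_right]
  | succ k ih =>
    rw [mulPow_succ, ← ih, ← ih, pow_succ', mul_smul, hcoeff_mono_sub_smul]
    congr 2
    · rw [sub_smul, one_smul]; abel
    · rw [sub_smul, one_smul]; abel

/-- `F` and `G` have the same coefficients once the exponents are permuted by `π`. -/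
def Permuted (π : Γ ≃+ Γ) (F G : HahnModule Γ K W) : Prop := ∀ γ, hcoeff G (π γ) = hcoeff F γ

variable (K W) in
/-- The pairs `(f, g)` of scalars for which `f F` and `g G` have the same coefficients, up to the
permutation `π` of the exponents, whenever `F` and `G` do. -/
def permSubring (π : Γ ≃+ Γ) : Subring (HahnSeries Γ K × HahnSeries Γ K) where
  carrier := {f | ∀ F G : HahnModule Γ K W, Permuted π F G → Permuted π (f.1 • F) (f.2 • G)}
  mul_mem' hf hg F G h := by
    simp only [Prod.fst_mul, Prod.snd_mul, mul_smul]
    exact hf _ _ (hg _ _ h)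
  one_mem' F G h := by simpa using h
  add_mem' hf hg F G h γ := by
    simp only [Prod.fst_add, Prod.snd_add, add_smul, hcoeff_add]
    rw [hf _ _ h, hg _ _ h]
  zero_mem' F G h γ := by simp
  neg_mem' hf F G h γ := by
    simp only [Prod.fst_neg, Prod.snd_neg, neg_smul, hcoeff_neg]
    rw [hf _ _ h]

theorem mono_mem_permSubring (π : Γ ≃+ Γ) (g : Γ) :
    (mono K g, mono K (π g)) ∈ permSubring K W π := fun F G h γ => by
  simp only [hcoeff_mono_smul]
  rw [← map_sub, h]

theorem mono_zpow_mem_permSubring (π : Γ ≃+ Γ) (g : Γ) (n : ℤ) :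
    (mono K g ^ n, mono K (π g) ^ n) ∈ permSubring K W π := by
  rw [mono_zpow, mono_zpow, ← map_zsmul]
  exact mono_mem_permSubring π _

theorem mono_sub_mem_permSubring (π : Γ ≃+ Γ) (g h : Γ) :
    (mono K g - mono K h, mono K (π g) - mono K (π h)) ∈ permSubring K W π := by
  rw [← Prod.mk_sub_mk]
  exact sub_mem (mono_mem_permSubring π g) (mono_mem_permSubring π h)

/-- Division by `x - y` commutes with a permutation of the exponents which preserves the order of
`x` and `y`: the discrepancy between the two quotients is constant along a progression of exponents
going to `-∞`, along which both quotients vanish eventually. -/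
theorem inv_mono_sub_mem_permSubring (π : Γ ≃+ Γ) {g h : Γ} (hgh : g < h) (hπ : π g < π h) :
    ((mono K g - mono K h)⁻¹, (mono K (π g) - mono K (π h))⁻¹) ∈ permSubring K W π := by
  intro F G hFG γ
  set F' := (mono K g - mono K h)⁻¹ • F with hF'
  set G' := (mono K (π g) - mono K (π h))⁻¹ • G with hG'
  have eF : F = (mono K g - mono K h) • F' := by
    rw [hF', ← mul_smul, mul_inv_cancel₀ (mono_sub_ne_zero hgh.ne), one_smul]
  have eG : G = (mono K (π g) - mono K (π h)) • G' := by
    rw [hG', ← mul_smul, mul_inv_cancel₀ (mono_sub_ne_zero hπ.ne), one_smul]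
  have inv : ∀ γ, hcoeff G' (π γ) - hcoeff F' γ =
      hcoeff G' (π (γ - (h - g))) - hcoeff F' (γ - (h - g)) := by
    intro γ
    have := hFG (γ + g)
    rw [eF, eG, hcoeff_mono_sub_smul, hcoeff_mono_sub_smul, ← map_sub, ← map_sub,
      add_sub_cancel_right, show γ + g - h = γ - (h - g) by abel] at this
    rw [sub_eq_sub_iff_sub_eq_sub]
    exact this
  have inv' : ∀ n : ℕ, hcoeff G' (π γ) - hcoeff F' γ =
      hcoeff G' (π (γ - n • (h - g))) - hcoeff F' (γ - n • (h - g)) := by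
    intro n
    induction n with
    | zero => simp
    | succ n ih => rw [ih, inv, add_smul, one_smul, sub_sub]
  obtain ⟨N, hN⟩ := exists_hcoeff_sub_nsmul_eq_zero F' γ (sub_pos.2 hgh)
  obtain ⟨M, hM⟩ := exists_hcoeff_sub_nsmul_eq_zero G' (π γ) (sub_pos.2 hπ)
  have := inv' (max N M)
  rw [hN _ (le_max_left _ _), map_sub, map_nsmul, map_sub, hM _ (le_max_right _ _), sub_zero,
    sub_eq_zero] at this
  exact this

theorem mono_sub_zpow_mem_permSubring (π : Γ ≃+ Γ) {g h : Γ} (hgh : g < h) (hπ : π g < π h)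
    (n : ℤ) :
    ((mono K g - mono K h) ^ n, (mono K (π g) - mono K (π h)) ^ n) ∈ permSubring K W π := by
  obtain ⟨m, rfl | rfl⟩ := n.eq_nat_or_neg
  · simpa using pow_mem (mono_sub_mem_permSubring (W := W) π g h) m
  · simpa using pow_mem (inv_mono_sub_mem_permSubring (W := W) (K := K) π hgh hπ) m

/-- `mono_sub_zpow_mem_permSubring` with the smaller monomial subtracted from the larger one. -/
theorem mono_sub_zpow_mem_permSubring' (π : Γ ≃+ Γ) {g h : Γ} (hgh : g < h) (hπ : π g < π h)
    (n : ℤ) :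
    ((mono K h - mono K g) ^ n, (mono K (π h) - mono K (π g)) ^ n) ∈ permSubring K W π := by
  have h1 : ((-1 : HahnSeries Γ K) ^ n, (-1 : HahnSeries Γ K) ^ n) ∈ permSubring K W π := by
    rcases Int.even_or_odd n with hn | hn
    · rw [hn.neg_one_zpow]; exact one_mem _
    · rw [hn.neg_one_zpow]; exact neg_mem (one_mem _)
  have := mul_mem h1 (mono_sub_zpow_mem_permSubring (K := K) (W := W) π hgh hπ n)
  rw [Prod.mk_mul_mk, ← mul_zpow, ← mul_zpow] at this
  simpa using this

end Hahn

/-! ### Taylor expansion with remainder -/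

section Remainder

/-- Taylor's formula with remainder for `c^l = (a - b)^l`: after `N` terms the remainder is `b^N`
times a polynomial in `a^±1`, `c^±1`. It is stated for two triples `(a, b, c)` at once, so that
the two cofactors form a pair in a given subring. -/
theorem exists_zpow_sub_sum_eq {F : Type*} [Field F] (S : Subring (F × F)) {a b c a' b' c' : F}
    (hc : c = a - b) (hc' : c' = a' - b') (ha0 : a ≠ 0) (ha0' : a' ≠ 0) (hc0 : c ≠ 0)
    (hc0' : c' ≠ 0) (ha : ∀ n : ℤ, (a ^ n, a' ^ n) ∈ S) (hcS : ∀ n : ℤ, (c ^ n, c' ^ n) ∈ S)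
    (l : ℤ) (N : ℕ) :
    ∃ g ∈ S, c ^ l - ∑ i ∈ Finset.range N, (binomCoeff l i : F) * (a ^ (l - i) * b ^ i) =
        b ^ N * g.1 ∧
      c' ^ l - ∑ i ∈ Finset.range N, (binomCoeff l i : F) * (a' ^ (l - i) * b' ^ i) =
        b' ^ N * g.2 := by
  rcases N with _ | N
  · exact ⟨_, hcS l, by simp, by simp⟩
  have pascal : ∀ (a b : F), a ≠ 0 → ∀ l : ℤ,
      ∑ i ∈ Finset.range (N + 1), (binomCoeff (l + 1) i : F) * (a ^ (l + 1 - i) * b ^ i) =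
      (a - b) * ∑ i ∈ Finset.range (N + 1), (binomCoeff l i : F) * (a ^ (l - i) * b ^ i) +
        b ^ (N + 1) * ((binomCoeff l N : F) * a ^ (l - N)) := by
    intro a b ha l
    have sub_right : ∀ x y z : F, x + y - z = x - z + y := fun x y z => by ring
    have h1 : ∑ i ∈ Finset.range (N + 1), (binomCoeff (l + 1) i : F) * (a ^ (l + 1 - i) * b ^ i) =
        a * ∑ i ∈ Finset.range (N + 1), (binomCoeff l i : F) * (a ^ (l - i) * b ^ i) -
        b * ∑ i ∈ Finset.range N, (binomCoeff l i : F) * (a ^ (l - i) * b ^ i) := by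
      rw [Finset.sum_range_succ', Finset.sum_range_succ' _ N, mul_add, Finset.mul_sum,
        Finset.mul_sum, sub_right, ← Finset.sum_sub_distrib]
      congr 1
      · refine Finset.sum_congr rfl fun i _ => ?_
        rw [binomCoeff_succ]
        have e1 : a ^ (l + 1 - ((i + 1 : ℕ) : ℤ)) = a ^ (l - i) := by
          congr 1; push_cast; ring
        have e2 : a ^ (l - i) = a * a ^ (l - ((i + 1 : ℕ) : ℤ)) := by
          rw [← zpow_one_add₀ ha]; congr 1; push_cast; ring
        rw [e1]
        push_cast
        rw [pow_succ]
        push_cast at e2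
        linear_combination (binomCoeff l (i + 1) : F) * b ^ i * b * e2
      · rw [binomCoeff_zero_right, binomCoeff_zero_right]
        have e2 : a ^ (l + 1 - ((0 : ℕ) : ℤ)) = a * a ^ (l - ((0 : ℕ) : ℤ)) := by
          rw [← zpow_one_add₀ ha]; congr 1; ring
        rw [e2]; ring
    rw [h1, Finset.sum_range_succ]
    ring
  have hb : ∀ (z n : ℤ), (((z : F), (z : F)) : F × F) * (a ^ n, a' ^ n) ∈ S := fun z n =>
    mul_mem (intCast_mem S z) (ha n)
  induction l with
  | zero =>
    refine ⟨0, zero_mem S, ?_, ?_⟩ <;>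
    · rw [Finset.sum_range_succ']
      simp [binomCoeff_zero_succ, binomCoeff_zero_right]
  | succ i ih =>
    obtain ⟨g, hg, e, e'⟩ := ih
    refine ⟨(c ^ (1 : ℤ), c' ^ (1 : ℤ)) * g -
      ((binomCoeff i N : F), (binomCoeff i N : F)) * (a ^ ((i : ℤ) - N), a' ^ ((i : ℤ) - N)),
      sub_mem (mul_mem (hcS 1) hg) (hb _ _), ?_, ?_⟩
    · rw [pascal a b ha0, zpow_add_one₀ hc0, ← hc]
      simp only [Prod.fst_sub, Prod.fst_mul, zpow_one]
      linear_combination c * e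
    · rw [pascal a' b' ha0', zpow_add_one₀ hc0', ← hc']
      simp only [Prod.snd_sub, Prod.snd_mul, zpow_one]
      linear_combination c' * e'
  | pred i ih =>
    obtain ⟨g, hg, e, e'⟩ := ih
    refine ⟨(c ^ (-1 : ℤ), c' ^ (-1 : ℤ)) * (g +
      ((binomCoeff (-(i : ℤ) - 1) N : F), (binomCoeff (-(i : ℤ) - 1) N : F)) *
        (a ^ (-(i : ℤ) - 1 - N), a' ^ (-(i : ℤ) - 1 - N))),
      mul_mem (hcS _) (add_mem hg (hb _ _)), ?_, ?_⟩
    · have p := pascal a b ha0 (-(i : ℤ) - 1)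
      rw [sub_add_cancel, ← hc] at p
      rw [p] at e
      apply mul_left_cancel₀ hc0
      rw [mul_sub, ← zpow_one_add₀ hc0, add_sub_cancel]
      simp only [Prod.fst_add, Prod.fst_mul, zpow_neg_one]
      have := mul_inv_cancel₀ hc0
      linear_combination e - (b ^ (N + 1) * (g.1 +
        (binomCoeff (-(i : ℤ) - 1) N : F) * a ^ (-(i : ℤ) - 1 - N))) * this
    · have p := pascal a' b' ha0' (-(i : ℤ) - 1)
      rw [sub_add_cancel, ← hc'] at p
      rw [p] at e'
      apply mul_left_cancel₀ hc0'
      rw [mul_sub, ← zpow_one_add₀ hc0', add_sub_cancel]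
      simp only [Prod.snd_add, Prod.snd_mul, zpow_neg_one]
      have := mul_inv_cancel₀ hc0'
      linear_combination e' - (b' ^ (N + 1) * (g.2 +
        (binomCoeff (-(i : ℤ) - 1) N : F) * a' ^ (-(i : ℤ) - 1 - N))) * this

end Remainder

/-! ### The two expansions of a power of a difference -/

section Expansion

/-- The coefficient of `x^p y^q` in `(x - y)^l F(x, y)`, where `(x - y)^l` is expanded in
nonnegative powers of `y`. -/
def expandL {M : Type*} [AddCommGroup M] (l : ℤ) (F : ℤ → ℤ → M) (p q : ℤ) : M :=
  ∑ᶠ i : ℕ, binomCoeff l i • F (p - l + i) (q - i)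

/-- The coefficient of `x^p y^q` in `(x - y)^l F(x, y)`, where `(x - y)^l = (-1)^l (y - x)^l` is
expanded in nonnegative powers of `x`. -/
def expandR {M : Type*} [AddCommGroup M] (l : ℤ) (F : ℤ → ℤ → M) (p q : ℤ) : M :=
  ((Int.negOnePow l : ℤˣ) : ℤ) • ∑ᶠ i : ℕ, binomCoeff l i • F (p - i) (q - l + i)

theorem expandL_finite {M : Type*} [AddCommGroup M] {F : ℤ → ℤ → M}
    (hF : ∃ N : ℤ, ∀ p, ∀ q < N, F p q = 0) (c : ℕ → ℤ) (l p q : ℤ) :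
    (Function.support fun i : ℕ => c i • F (p - l + i) (q - i)).Finite := by
  obtain ⟨N, hN⟩ := hF
  refine (Set.finite_lt_nat (q - N + 1).toNat).subset fun i hi => ?_
  by_contra hc
  refine hi ?_
  simp only [Set.mem_ofPred_eq, not_lt] at hc
  simp only
  rw [hN _ _ (by omega), smul_zero]

theorem expandR_finite {M : Type*} [AddCommGroup M] {F : ℤ → ℤ → M}
    (hF : ∃ N : ℤ, ∀ p < N, ∀ q, F p q = 0) (c : ℕ → ℤ) (l p q : ℤ) :
    (Function.support fun i : ℕ => c i • F (p - i) (q - l + i)).Finite := by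
  obtain ⟨N, hN⟩ := hF
  refine (Set.finite_lt_nat (p - N + 1).toNat).subset fun i hi => ?_
  by_contra hc
  refine hi ?_
  simp only [Set.mem_ofPred_eq, not_lt] at hc
  simp only
  rw [hN _ (by omega), smul_zero]

theorem map_expandL {M M' : Type*} [AddCommGroup M] [AddCommGroup M'] (f : M →+ M')
    {F : ℤ → ℤ → M} (hF : ∃ N : ℤ, ∀ p, ∀ q < N, F p q = 0) (l p q : ℤ) :
    f (expandL l F p q) = expandL l (fun p q => f (F p q)) p q := by
  rw [expandL, f.map_finsum (expandL_finite hF _ l p q)]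
  simp only [map_zsmul, expandL]

theorem map_expandR {M M' : Type*} [AddCommGroup M] [AddCommGroup M'] (f : M →+ M')
    {F : ℤ → ℤ → M} (hF : ∃ N : ℤ, ∀ p < N, ∀ q, F p q = 0) (l p q : ℤ) :
    f (expandR l F p q) = expandR l (fun p q => f (F p q)) p q := by
  rw [expandR, map_zsmul, f.map_finsum (expandR_finite hF _ l p q)]
  simp only [map_zsmul, expandR]

theorem expandL_add {M : Type*} [AddCommGroup M] {F G : ℤ → ℤ → M}
    (hF : ∃ N : ℤ, ∀ p, ∀ q < N, F p q = 0) (hG : ∃ N : ℤ, ∀ p, ∀ q < N, G p q = 0) (l p q : ℤ) :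
    expandL l (fun p q => F p q + G p q) p q = expandL l F p q + expandL l G p q := by
  simp only [expandL, smul_add]
  exact finsum_add_distrib (expandL_finite hF _ l p q) (expandL_finite hG _ l p q)

theorem expandR_add {M : Type*} [AddCommGroup M] {F G : ℤ → ℤ → M}
    (hF : ∃ N : ℤ, ∀ p < N, ∀ q, F p q = 0) (hG : ∃ N : ℤ, ∀ p < N, ∀ q, G p q = 0) (l p q : ℤ) :
    expandR l (fun p q => F p q + G p q) p q = expandR l F p q + expandR l G p q := by
  simp only [expandR, smul_add]
  rw [finsum_add_distrib (expandR_finite hF _ l p q) (expandR_finite hG _ l p q), smul_add]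

variable {Γ : Type*} [AddCommGroup Γ] [LinearOrder Γ] [IsOrderedAddMonoid Γ]
  {K : Type*} [Field K] {W : Type*} [AddCommGroup W] [Module K W]

theorem expandL_hcoeff {g h : Γ} (hgh : g < h) (F : HahnModule Γ K W) (γ : Γ) (l p q : ℤ) :
    expandL l (fun p q => hcoeff F (γ + p • g + q • h)) p q =
      hcoeff ((mono K g - mono K h) ^ l • F) (γ + p • g + q • h) := by
  rw [hcoeff_sub_zpow_smul hgh, expandL]
  refine finsum_congr fun i => ?_
  congr 2
  rw [← natCast_zsmul]
  module

theorem expandR_hcoeff {g h : Γ} (hgh : g < h) (F : HahnModule Γ K W) (γ : Γ) (l p q : ℤ) :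
    expandR l (fun p q => hcoeff F (γ + p • h + q • g)) p q =
      hcoeff ((mono K h - mono K g) ^ l • F) (γ + p • h + q • g) := by
  have hs : (mono K h - mono K g) ^ l • F =
      ((Int.negOnePow l : ℤˣ) : ℤ) • (mono K g - mono K h) ^ l • F := by
    rw [← neg_sub (mono K g), neg_eq_neg_one_mul, mul_zpow, mul_smul]
    rcases Int.even_or_odd l with hl | hl
    · rw [hl.neg_one_zpow, Int.negOnePow_even l hl]; simp
    · rw [hl.neg_one_zpow, Int.negOnePow_odd l hl]; simp
  have hz : ∀ (n : ℤ) (G : HahnModule Γ K W) γ, hcoeff (n • G) γ = n • hcoeff G γ := by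
    intro n G γ
    exact map_zsmul (⟨⟨fun G => hcoeff G γ, rfl⟩, fun _ _ => rfl⟩ : HahnModule Γ K W →+ W) n G
  rw [hs, hz, hcoeff_sub_zpow_smul hgh, expandR]
  congr 1
  refine finsum_congr fun i => ?_
  congr 2
  rw [← natCast_zsmul]
  module

theorem expandL_hcoeff_sub {g h g' h' : Γ} (hgh : g < h) (hgh' : g' < h') (F F' : HahnModule Γ K W)
    (γ γ' : Γ) (l p q : ℤ) :
    expandL l (fun p q => hcoeff F (γ + p • g + q • h) - hcoeff F' (γ' + p • g' + q • h')) p q =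
      hcoeff ((mono K g - mono K h) ^ l • F) (γ + p • g + q • h) -
      hcoeff ((mono K g' - mono K h') ^ l • F') (γ' + p • g' + q • h') := by
  have fin : ∀ {g h : Γ} (_ : g < h) (F : HahnModule Γ K W) (γ : Γ), (Function.support fun i : ℕ =>
      binomCoeff l i • hcoeff F (γ + (p - l + i) • g + (q - i) • h)).Finite := by
    intro g h hgh F γ
    convert hcoeff_support_finite F (γ + (p - l) • g + q • h) (sub_pos.2 hgh) (binomCoeff l)
      using 5 with i
    rw [← natCast_zsmul]
    module
  rw [← expandL_hcoeff hgh, ← expandL_hcoeff hgh']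
  simp only [expandL, smul_sub (binomCoeff l _)]
  exact finsum_sub_distrib (fin hgh F γ) (fin hgh' F' γ')

theorem expandR_hcoeff_sub {g h g' h' : Γ} (hgh : g < h) (hgh' : g' < h') (F F' : HahnModule Γ K W)
    (γ γ' : Γ) (l p q : ℤ) :
    expandR l (fun p q => hcoeff F (γ + p • h + q • g) - hcoeff F' (γ' + p • h' + q • g')) p q =
      hcoeff ((mono K h - mono K g) ^ l • F) (γ + p • h + q • g) -
      hcoeff ((mono K h' - mono K g') ^ l • F') (γ' + p • h' + q • g') := by
  have fin : ∀ {g h : Γ} (_ : g < h) (F : HahnModule Γ K W) (γ : Γ), (Function.support fun i : ℕ =>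
      binomCoeff l i • hcoeff F (γ + (p - i) • h + (q - l + i) • g)).Finite := by
    intro g h hgh F γ
    convert hcoeff_support_finite F (γ + p • h + (q - l) • g) (sub_pos.2 hgh) (binomCoeff l)
      using 5 with i
    rw [← natCast_zsmul]
    module
  rw [← expandR_hcoeff hgh, ← expandR_hcoeff hgh']
  simp only [expandR, smul_sub (binomCoeff l _)]
  rw [← smul_sub, finsum_sub_distrib (fin hgh F γ) (fin hgh' F' γ')]

end Expansion

/-! ### Words in three vertex operators and residue products -/

section Words

variable {K : Type*} [Field K] {W : Type*} [AddCommGroup W] [Module K W]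

/-- Exponents of monomials in three variables, the exponent of the last variable being the most
significant one.  So the inverse of a difference of two of the variables is expanded in nonnegative
powers of the later one. -/
abbrev Exps := ℤ ×ₗ (ℤ ×ₗ ℤ)

/-- The exponent of `u₁^p u₂^q u₃^s`. -/
def ex (p q s : ℤ) : Exps := toLex (s, toLex (q, p))

theorem ex_add (p q s p' q' s' : ℤ) : ex p q s + ex p' q' s' = ex (p + p') (q + q') (s + s') := rfl

theorem ex_sub (p q s p' q' s' : ℤ) : ex p q s - ex p' q' s' = ex (p - p') (q - q') (s - s') := rfl

theorem ex_zsmul (n p q s : ℤ) : n • ex p q s = ex (n * p) (n * q) (n * s) := rfl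

theorem ex_surj (γ : Exps) : ∃ p q s, γ = ex p q s := ⟨_, _, _, rfl⟩

theorem ex_eq_one_two (p q s : ℤ) : ex p q s = ex 0 0 s + p • ex 1 0 0 + q • ex 0 1 0 := by
  rw [ex_zsmul, ex_zsmul, ex_add, ex_add]; simp
theorem ex_eq_two_one (p q s : ℤ) : ex p q s = ex 0 0 s + q • ex 0 1 0 + p • ex 1 0 0 := by
  rw [ex_zsmul, ex_zsmul, ex_add, ex_add]; simp
theorem ex_eq_one_three (p q s : ℤ) : ex p q s = ex 0 q 0 + p • ex 1 0 0 + s • ex 0 0 1 := by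
  rw [ex_zsmul, ex_zsmul, ex_add, ex_add]; simp
theorem ex_eq_three_one (p q s : ℤ) : ex p q s = ex 0 q 0 + s • ex 0 0 1 + p • ex 1 0 0 := by
  rw [ex_zsmul, ex_zsmul, ex_add, ex_add]; simp
theorem ex_eq_two_three (p q s : ℤ) : ex p q s = ex p 0 0 + q • ex 0 1 0 + s • ex 0 0 1 := by
  rw [ex_zsmul, ex_zsmul, ex_add, ex_add]; simp
theorem ex_eq_three_two (p q s : ℤ) : ex p q s = ex p 0 0 + s • ex 0 0 1 + q • ex 0 1 0 := by
  rw [ex_zsmul, ex_zsmul, ex_add, ex_add]; simp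

theorem ex_one_lt_two : ex 1 0 0 < ex 0 1 0 := by simp [ex, Prod.Lex.toLex_lt_toLex]
theorem ex_two_lt_three : ex 0 1 0 < ex 0 0 1 := by simp [ex, Prod.Lex.toLex_lt_toLex]
theorem ex_one_lt_three : ex 1 0 0 < ex 0 0 1 := by simp [ex, Prod.Lex.toLex_lt_toLex]

variable (K) in
/-- The variable `u₁`, as a Hahn series. -/
def u₁ : HahnSeries Exps K := mono K (ex 1 0 0)
variable (K) in
/-- The variable `u₂`, as a Hahn series. -/
def u₂ : HahnSeries Exps K := mono K (ex 0 1 0)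
variable (K) in
/-- The variable `u₃`, as a Hahn series. -/
def u₃ : HahnSeries Exps K := mono K (ex 0 0 1)

/-- Interchange of the exponents of `u₁` and `u₂`. -/
def swapLeft : Exps ≃+ Exps where
  toFun γ := toLex ((ofLex γ).1, toLex ((ofLex (ofLex γ).2).2, (ofLex (ofLex γ).2).1))
  invFun γ := toLex ((ofLex γ).1, toLex ((ofLex (ofLex γ).2).2, (ofLex (ofLex γ).2).1))
  left_inv _ := rfl
  right_inv _ := rfl
  map_add' _ _ := rfl

/-- Interchange of the exponents of `u₂` and `u₃`. -/
def swapRight : Exps ≃+ Exps where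
  toFun γ := toLex ((ofLex (ofLex γ).2).1, toLex ((ofLex γ).1, (ofLex (ofLex γ).2).2))
  invFun γ := toLex ((ofLex (ofLex γ).2).1, toLex ((ofLex γ).1, (ofLex (ofLex γ).2).2))
  left_inv _ := rfl
  right_inv _ := rfl
  map_add' _ _ := rfl

theorem swapLeft_ex (p q s : ℤ) : swapLeft (ex p q s) = ex q p s := rfl
theorem swapRight_ex (p q s : ℤ) : swapRight (ex p q s) = ex p s q := rfl

/-- The coefficient of `x^p` in a vertex operator `a(x)`. -/
def fcoeff (a : VertexOperator K W) (p : ℤ) : Module.End K W := HVertexOperator.coeff a p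

theorem exists_fcoeff_eq_zero (a : VertexOperator K W) (w : W) :
    ∃ N : ℤ, ∀ p < N, fcoeff a p w = 0 :=
  ⟨_, fun _ hp => VertexOperator.coeff_eq_zero_of_lt_order a _ w hp⟩

/-- `a(u₁) b(u₂) c(u₃) w`, as a Hahn series. -/
def word (a b c : VertexOperator K W) (w : W) : HahnModule Exps K W :=
  HVertexOperator.comp (HVertexOperator.comp a b) c w

theorem hcoeff_word (a b c : VertexOperator K W) (w : W) (p q s : ℤ) :
    hcoeff (word a b c w) (ex p q s) = fcoeff a p (fcoeff b q (fcoeff c s w)) := rfl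

/-- `(x - y)^k a(x) b(y) = (x - y)^k b(y) a(x)`. -/
def LocalAt (k : ℕ) (a b : VertexOperator K W) : Prop :=
  ∀ p q : ℤ, mulPow k (fun p q => fcoeff a p * fcoeff b q) p q =
    mulPow k (fun p q => fcoeff b q * fcoeff a p) p q

theorem map_mulPow {M M' : Type*} [AddCommGroup M] [AddCommGroup M'] (f : M →+ M') (k : ℕ)
    (F : ℤ → ℤ → M) (p q : ℤ) : f (mulPow k F p q) = mulPow k (fun p q => f (F p q)) p q := by
  simp [mulPow, map_sum, map_zsmul]

theorem LocalAt.apply {k : ℕ} {a b : VertexOperator K W} (h : LocalAt k a b) (w : W) (p q : ℤ) :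
    mulPow k (fun p q => fcoeff a p (fcoeff b q w)) p q =
      mulPow k (fun p q => fcoeff b q (fcoeff a p w)) p q := by
  have := congrArg (LinearMap.applyₗ w : Module.End K W →ₗ[K] W).toAddMonoidHom (h p q)
  rw [map_mulPow, map_mulPow] at this
  exact this

theorem LocalAt.permuted_left {k : ℕ} {a b : VertexOperator K W} (h : LocalAt k a b)
    (c : VertexOperator K W) (w : W) :
    Permuted swapLeft ((u₁ K - u₂ K) ^ k • word a b c w) ((u₂ K - u₁ K) ^ k • word b a c w) := by
  intro γ
  obtain ⟨p, q, s, rfl⟩ := ex_surj γ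
  rw [swapLeft_ex, ex_eq_one_two p q s, ex_eq_two_one q p s, u₁, u₂, hcoeff_sub_pow_smul,
    hcoeff_sub_pow_smul]
  simp only [← ex_eq_one_two, ← ex_eq_two_one, hcoeff_word]
  exact (h.apply _ p q).symm

theorem LocalAt.permuted_right {k : ℕ} {b c : VertexOperator K W} (h : LocalAt k b c)
    (a : VertexOperator K W) (w : W) :
    Permuted swapRight ((u₂ K - u₃ K) ^ k • word a b c w) ((u₃ K - u₂ K) ^ k • word a c b w) := by
  intro γ
  obtain ⟨p, q, s, rfl⟩ := ex_surj γ
  rw [swapRight_ex, ex_eq_two_three p q s, ex_eq_three_two p s q, u₂, u₃, hcoeff_sub_pow_smul,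
    hcoeff_sub_pow_smul]
  simp only [← ex_eq_two_three, ← ex_eq_three_two, hcoeff_word]
  have := congrArg (fcoeff a p).toAddMonoidHom (h.apply w q s)
  rw [map_mulPow, map_mulPow] at this
  exact this.symm

/-- A scalar that is `(x - y)^k` times a function regular at `x = y` does not see the order of the
letters `a(x)` and `b(y)`. -/
theorem LocalAt.hcoeff_swapLeft {k : ℕ} {a b : VertexOperator K W} (h : LocalAt k a b)
    (c : VertexOperator K W) (w : W) {f f' : HahnSeries Exps K}
    {g : HahnSeries Exps K × HahnSeries Exps K}
    (hg : g ∈ permSubring K W swapLeft) {n : ℤ} (hn : k ≤ n)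
    (hf : f = (u₁ K - u₂ K) ^ n * g.1) (hf' : f' = (u₂ K - u₁ K) ^ n * g.2) (p q s : ℤ) :
    hcoeff (f • word a b c w) (ex p q s) = hcoeff (f' • word b a c w) (ex q p s) := by
  obtain ⟨j, rfl⟩ : ∃ j : ℕ, n = (j + k : ℕ) := ⟨(n - k).toNat, by push_cast; omega⟩
  have hB : (u₁ K - u₂ K, u₂ K - u₁ K) ∈ permSubring K W swapLeft :=
    mono_sub_mem_permSubring swapLeft (ex 1 0 0) (ex 0 1 0)
  have := mul_mem hg (pow_mem hB j) _ _ (h.permuted_left c w) (ex p q s)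
  rw [swapLeft_ex] at this
  simp only [Prod.fst_mul, Prod.snd_mul, Prod.pow_fst, Prod.pow_snd, ← mul_smul] at this
  rw [hf, hf', zpow_natCast, zpow_natCast, pow_add, pow_add, mul_comm _ g.1, mul_comm _ g.2,
    ← mul_assoc, ← mul_assoc, this]

/-- A scalar that is `(y - z)^k` times a function regular at `y = z` does not see the order of the
letters `b(y)` and `c(z)`. -/
theorem LocalAt.hcoeff_swapRight {k : ℕ} {b c : VertexOperator K W} (h : LocalAt k b c)
    (a : VertexOperator K W) (w : W) {f f' : HahnSeries Exps K}
    {g : HahnSeries Exps K × HahnSeries Exps K}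
    (hg : g ∈ permSubring K W swapRight) {n : ℤ} (hn : k ≤ n)
    (hf : f = (u₂ K - u₃ K) ^ n * g.1) (hf' : f' = (u₃ K - u₂ K) ^ n * g.2) (p q s : ℤ) :
    hcoeff (f • word a b c w) (ex p q s) = hcoeff (f' • word a c b w) (ex p s q) := by
  obtain ⟨j, rfl⟩ : ∃ j : ℕ, n = (j + k : ℕ) := ⟨(n - k).toNat, by push_cast; omega⟩
  have hB : (u₂ K - u₃ K, u₃ K - u₂ K) ∈ permSubring K W swapRight :=
    mono_sub_mem_permSubring swapRight (ex 0 1 0) (ex 0 0 1)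
  have := mul_mem hg (pow_mem hB j) _ _ (h.permuted_right a w) (ex p q s)
  rw [swapRight_ex] at this
  simp only [Prod.fst_mul, Prod.snd_mul, Prod.pow_fst, Prod.pow_snd, ← mul_smul] at this
  rw [hf, hf', zpow_natCast, zpow_natCast, pow_add, pow_add, mul_comm _ g.1, mul_comm _ g.2,
    ← mul_assoc, ← mul_assoc, this]

/-- The coefficient of `y^q` in `(a_(l) b)(y) w`, where
`a_(l) b = Res_x ((x - y)^l a(x) b(y) - (-y + x)^l b(y) a(x))` is the residue product. -/
def resProd (l : ℤ) (a b : VertexOperator K W) (q : ℤ) (w : W) : W :=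
  expandL l (fun p q => fcoeff a p (fcoeff b q w)) (-1) q -
    expandR l (fun p q => fcoeff b q (fcoeff a p w)) (-1) q

theorem bdd_left (a b : VertexOperator K W) (w : W) :
    ∃ N : ℤ, ∀ p, ∀ q < N, fcoeff a p (fcoeff b q w) = 0 := by
  obtain ⟨N, hN⟩ := exists_fcoeff_eq_zero b w
  exact ⟨N, fun p q hq => by rw [hN q hq, map_zero]⟩

theorem bdd_right (a b : VertexOperator K W) (w : W) :
    ∃ N : ℤ, ∀ p < N, ∀ q, fcoeff b q (fcoeff a p w) = 0 := by
  obtain ⟨N, hN⟩ := exists_fcoeff_eq_zero a w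
  exact ⟨N, fun p hp q => by rw [hN p hp, map_zero]⟩

/-- `a_(l) (b_(q) c)` as a combination of words with three letters. -/
theorem resProd_right (a b c e : VertexOperator K W) (P Q : ℤ)
    (he : ∀ s w, fcoeff e s w = resProd Q b c s w) (s : ℤ) (w : W) :
    resProd P a e s w =
      hcoeff (((u₁ K - u₃ K) ^ P * (u₂ K - u₃ K) ^ Q) • word a b c w) (ex (-1) (-1) s) -
      hcoeff (((u₁ K - u₂ K) ^ P * (u₃ K - u₂ K) ^ Q) • word a c b w) (ex (-1) s (-1)) -
      hcoeff (((u₃ K - u₂ K) ^ P * (u₁ K - u₂ K) ^ Q) • word b c a w) (ex (-1) s (-1)) +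
      hcoeff (((u₃ K - u₁ K) ^ P * (u₂ K - u₁ K) ^ Q) • word c b a w) (ex s (-1) (-1)) := by
  have h1 : (fun p s => fcoeff a p (fcoeff e s w)) = fun p s : ℤ =>
      hcoeff ((u₂ K - u₃ K) ^ Q • word a b c w) (ex 0 (-1) 0 + p • ex 1 0 0 + s • ex 0 0 1) -
      hcoeff ((u₃ K - u₂ K) ^ Q • word a c b w) (ex 0 0 (-1) + p • ex 1 0 0 + s • ex 0 1 0) := by
    funext p s
    rw [← ex_eq_one_three, ← ex_eq_one_two, ex_eq_two_three p (-1) s,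
      ex_eq_three_two p s (-1), u₂, u₃,
      ← expandL_hcoeff ex_two_lt_three, ← expandR_hcoeff ex_two_lt_three, he, resProd, map_sub]
    simp only [← ex_eq_two_three, ← ex_eq_three_two, hcoeff_word]
    congr 1
    · exact map_expandL (fcoeff a p).toAddMonoidHom (bdd_left b c w) _ _ _
    · exact map_expandR (fcoeff a p).toAddMonoidHom (bdd_right b c w) _ _ _
  have h2 : (fun p s => fcoeff e s (fcoeff a p w)) = fun p s : ℤ =>
      hcoeff ((u₁ K - u₂ K) ^ Q • word b c a w) (ex (-1) 0 0 + p • ex 0 0 1 + s • ex 0 1 0) -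
      hcoeff ((u₂ K - u₁ K) ^ Q • word c b a w) (ex 0 (-1) 0 + p • ex 0 0 1 + s • ex 1 0 0) := by
    funext p s
    rw [← ex_eq_three_two, ← ex_eq_three_one, ex_eq_one_two, ex_eq_two_one s, u₁, u₂,
      ← expandL_hcoeff ex_one_lt_two, ← expandR_hcoeff ex_one_lt_two, he, resProd]
    simp only [← ex_eq_one_two, ← ex_eq_two_one, hcoeff_word]
  rw [resProd, h1, h2, expandL_hcoeff_sub ex_one_lt_three ex_one_lt_two,
    expandR_hcoeff_sub ex_two_lt_three ex_one_lt_three]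
  simp only [← ex_eq_one_two, ← ex_eq_one_three, ← ex_eq_three_one, ← ex_eq_three_two, mul_smul]
  rw [← sub_add]
  rfl

/-- `(a_(l) b)_(q) c` as a combination of words with three letters. -/
theorem resProd_left (a b c e : VertexOperator K W) (L R : ℤ)
    (he : ∀ s w, fcoeff e s w = resProd L a b s w) (s : ℤ) (w : W) :
    resProd R e c s w =
      hcoeff (((u₁ K - u₂ K) ^ L * (u₂ K - u₃ K) ^ R) • word a b c w) (ex (-1) (-1) s) -
      hcoeff (((u₂ K - u₁ K) ^ L * (u₁ K - u₃ K) ^ R) • word b a c w) (ex (-1) (-1) s) -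
      hcoeff (((u₂ K - u₃ K) ^ L * (u₃ K - u₁ K) ^ R) • word c a b w) (ex s (-1) (-1)) +
      hcoeff (((u₃ K - u₂ K) ^ L * (u₂ K - u₁ K) ^ R) • word c b a w) (ex s (-1) (-1)) := by
  have h1 : (fun p s => fcoeff e p (fcoeff c s w)) = fun p s : ℤ =>
      hcoeff ((u₁ K - u₂ K) ^ L • word a b c w) (ex (-1) 0 0 + p • ex 0 1 0 + s • ex 0 0 1) -
      hcoeff ((u₂ K - u₁ K) ^ L • word b a c w) (ex 0 (-1) 0 + p • ex 1 0 0 + s • ex 0 0 1) := by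
    funext p s
    rw [← ex_eq_two_three, ← ex_eq_one_three, ex_eq_one_two, ex_eq_two_one p, u₁, u₂,
      ← expandL_hcoeff ex_one_lt_two, ← expandR_hcoeff ex_one_lt_two, he, resProd]
    simp only [← ex_eq_one_two, ← ex_eq_two_one, hcoeff_word]
  have h2 : (fun p s => fcoeff c s (fcoeff e p w)) = fun p s : ℤ =>
      hcoeff ((u₂ K - u₃ K) ^ L • word c a b w) (ex 0 (-1) 0 + p • ex 0 0 1 + s • ex 1 0 0) -
      hcoeff ((u₃ K - u₂ K) ^ L • word c b a w) (ex 0 0 (-1) + p • ex 0 1 0 + s • ex 1 0 0) := by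
    funext p s
    rw [← ex_eq_three_one, ← ex_eq_two_one, ex_eq_two_three s (-1) p,
      ex_eq_three_two s p (-1), u₂, u₃,
      ← expandL_hcoeff ex_two_lt_three, ← expandR_hcoeff ex_two_lt_three, he, resProd, map_sub]
    simp only [← ex_eq_two_three, ← ex_eq_three_two, hcoeff_word]
    congr 1
    · exact map_expandL (fcoeff c s).toAddMonoidHom (bdd_left a b w) _ _ _
    · exact map_expandR (fcoeff c s).toAddMonoidHom (bdd_right a b w) _ _ _
  rw [resProd, h1, h2, expandL_hcoeff_sub ex_two_lt_three ex_one_lt_three,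
    expandR_hcoeff_sub ex_one_lt_three ex_one_lt_two]
  simp only [← ex_eq_two_three, ← ex_eq_one_three, ← ex_eq_three_one, ← ex_eq_two_one]
  rw [← sub_add, mul_comm ((u₁ K - u₂ K) ^ L), mul_comm ((u₂ K - u₁ K) ^ L),
    mul_comm ((u₂ K - u₃ K) ^ L), mul_comm ((u₃ K - u₂ K) ^ L)]
  simp only [mul_smul]
  rfl

end Words

/-! ### The kernel of the Borcherds identity -/

section Kernels

variable {F : Type*} [Field F]

/-- The rational function `(x - y)^l (x - z)^P (y - z)^Q` in terms of `a = x - z` and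
`b = y - z`. -/
def kernel (l P Q : ℤ) (a b : F) : F := (a - b) ^ l * (a ^ P * b ^ Q)

/-- The first `N` terms of the expansion of `kernel l P Q a b` in powers of `b`. -/
def kernelRight (l P Q : ℤ) (N : ℕ) (a b : F) : F :=
  ∑ i ∈ Finset.range N, binomCoeff l i • (a ^ (P + l - i) * b ^ (Q + i))

/-- The first `N` terms of the expansion of `kernel l P Q a b` in powers of `a - b`. -/
def kernelDiag (l P Q : ℤ) (N : ℕ) (a b : F) : F :=
  ∑ i ∈ Finset.range N, (Ring.choose P i : ℤ) • ((a - b) ^ (l + i) * b ^ (P + Q - i))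

theorem kernel_swap (l P Q : ℤ) (a b : F) :
    kernel l P Q a b = ((Int.negOnePow l : ℤˣ) : ℤ) • kernel l Q P b a := by
  rw [kernel, kernel, ← neg_sub b a, neg_eq_neg_one_mul, mul_zpow, mul_comm (a ^ P)]
  rcases Int.even_or_odd l with hl | hl
  · rw [hl.neg_one_zpow, Int.negOnePow_even l hl]; simp
  · rw [hl.neg_one_zpow, Int.negOnePow_odd l hl]; simp

variable (S : Subring (F × F)) {a b a' b' : F} (ha : a ≠ 0) (ha' : a' ≠ 0) (hb : b ≠ 0)
  (hb' : b' ≠ 0) (hc : a - b ≠ 0) (hc' : a' - b' ≠ 0) (l P Q : ℤ) (N : ℕ)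

include ha ha' hb hb' hc hc' in
theorem exists_kernel_sub_kernelRight (hA : ∀ n : ℤ, (a ^ n, a' ^ n) ∈ S)
    (hC : ∀ n : ℤ, ((a - b) ^ n, (a' - b') ^ n) ∈ S) :
    ∃ g ∈ S, kernel l P Q a b - kernelRight l P Q N a b = b ^ (Q + N) * g.1 ∧
      kernel l P Q a' b' - kernelRight l P Q N a' b' = b' ^ (Q + N) * g.2 := by
  obtain ⟨g, hg, e, e'⟩ := exists_zpow_sub_sum_eq S rfl rfl ha ha' hc hc' hA hC l N
  have key : ∀ {a b : F}, a ≠ 0 → b ≠ 0 → kernel l P Q a b - kernelRight l P Q N a b =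
      a ^ P * b ^ Q * ((a - b) ^ l -
        ∑ i ∈ Finset.range N, (binomCoeff l i : F) * (a ^ (l - i) * b ^ i)) := by
    intro a b ha hb
    rw [mul_sub, Finset.mul_sum, kernel, kernelRight, mul_comm (a ^ P * b ^ Q)]
    congr 1
    refine Finset.sum_congr rfl fun i _ => ?_
    rw [zsmul_eq_mul, add_sub_assoc, zpow_add₀ ha, zpow_add₀ hb, zpow_natCast]
    ring
  refine ⟨_, mul_mem (hA P) hg, ?_, ?_⟩
  · rw [key ha hb, e, zpow_add₀ hb, zpow_natCast, Prod.fst_mul]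
    ring
  · rw [key ha' hb', e', zpow_add₀ hb', zpow_natCast, Prod.snd_mul]
    ring

include ha ha' hb hb' hc hc' in
theorem exists_kernel_sub_kernelDiag (hA : ∀ n : ℤ, (a ^ n, a' ^ n) ∈ S)
    (hB : ∀ n : ℤ, (b ^ n, b' ^ n) ∈ S) :
    ∃ g ∈ S, kernel l P Q a b - kernelDiag l P Q N a b = (a - b) ^ (l + N) * g.1 ∧
      kernel l P Q a' b' - kernelDiag l P Q N a' b' = (a' - b') ^ (l + N) * g.2 := by
  -- Expand `a^P = (b - (b - a))^P` in powers of `b - a`.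
  obtain ⟨g, hg, e, e'⟩ := exists_zpow_sub_sum_eq S (a := b) (b := b - a) (c := a) (a' := b')
    (b' := b' - a') (c' := a') (by ring) (by ring) hb hb' ha ha' hB hA P N
  have key : ∀ {a b : F}, a - b ≠ 0 → b ≠ 0 → kernel l P Q a b - kernelDiag l P Q N a b =
      (a - b) ^ l * b ^ Q * (a ^ P -
        ∑ i ∈ Finset.range N, (binomCoeff P i : F) * (b ^ (P - i) * (b - a) ^ i)) := by
    intro a b hc hb
    rw [mul_sub, Finset.mul_sum, kernel, kernelDiag]
    congr 1
    · ring
    refine Finset.sum_congr rfl fun i _ => ?_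
    rw [zsmul_eq_mul, show P + Q - i = P - i + Q by ring, zpow_add₀ hb, zpow_add₀ hc, zpow_natCast,
      ← neg_sub a b, neg_pow, binomCoeff]
    push_cast
    have : ((-1 : F) ^ i) * (-1) ^ i = 1 := by rw [← mul_pow]; simp
    linear_combination (-((Ring.choose P i : ℤ) : F) * (a - b) ^ l * (a - b) ^ i * b ^ (P - i) *
      b ^ Q) * this
  refine ⟨(-1) ^ N * ((b ^ Q, b' ^ Q) * g),
    mul_mem (pow_mem (neg_mem (one_mem S)) N) (mul_mem (hB Q) hg), ?_, ?_⟩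
  · rw [key hc hb, e, zpow_add₀ hc, zpow_natCast, ← neg_sub a b, neg_pow]
    simp only [Prod.fst_mul, Prod.pow_fst, Prod.fst_neg, Prod.fst_one]
    ring
  · rw [key hc' hb', e', zpow_add₀ hc', zpow_natCast, ← neg_sub a' b', neg_pow]
    simp only [Prod.snd_mul, Prod.pow_snd, Prod.snd_neg, Prod.snd_one]
    ring

end Kernels

/-! ### The Borcherds identity for three vertex operators -/

section Borcherds

variable {K : Type*} [Field K] {W : Type*} [AddCommGroup W] [Module K W]

theorem u₁_sub_u₂_ne_zero : u₁ K - u₂ K ≠ 0 := mono_sub_ne_zero ex_one_lt_two.ne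
theorem u₂_sub_u₁_ne_zero : u₂ K - u₁ K ≠ 0 := mono_sub_ne_zero ex_one_lt_two.ne'
theorem u₁_sub_u₃_ne_zero : u₁ K - u₃ K ≠ 0 := mono_sub_ne_zero ex_one_lt_three.ne
theorem u₃_sub_u₁_ne_zero : u₃ K - u₁ K ≠ 0 := mono_sub_ne_zero ex_one_lt_three.ne'
theorem u₂_sub_u₃_ne_zero : u₂ K - u₃ K ≠ 0 := mono_sub_ne_zero ex_two_lt_three.ne
theorem u₃_sub_u₂_ne_zero : u₃ K - u₂ K ≠ 0 := mono_sub_ne_zero ex_two_lt_three.ne'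

theorem u₁_sub_u₃_zpow_mem_left (n : ℤ) :
    ((u₁ K - u₃ K) ^ n, (u₂ K - u₃ K) ^ n) ∈ permSubring K W swapLeft :=
  mono_sub_zpow_mem_permSubring swapLeft ex_one_lt_three ex_two_lt_three n
theorem u₂_sub_u₃_zpow_mem_left (n : ℤ) :
    ((u₂ K - u₃ K) ^ n, (u₁ K - u₃ K) ^ n) ∈ permSubring K W swapLeft :=
  mono_sub_zpow_mem_permSubring swapLeft ex_two_lt_three ex_one_lt_three n
theorem u₃_sub_u₁_zpow_mem_left (n : ℤ) :
    ((u₃ K - u₁ K) ^ n, (u₃ K - u₂ K) ^ n) ∈ permSubring K W swapLeft :=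
  mono_sub_zpow_mem_permSubring' swapLeft ex_one_lt_three ex_two_lt_three n
theorem u₃_sub_u₂_zpow_mem_left (n : ℤ) :
    ((u₃ K - u₂ K) ^ n, (u₃ K - u₁ K) ^ n) ∈ permSubring K W swapLeft :=
  mono_sub_zpow_mem_permSubring' swapLeft ex_two_lt_three ex_one_lt_three n
theorem u₁_sub_u₂_zpow_mem_right (n : ℤ) :
    ((u₁ K - u₂ K) ^ n, (u₁ K - u₃ K) ^ n) ∈ permSubring K W swapRight :=
  mono_sub_zpow_mem_permSubring swapRight ex_one_lt_two ex_one_lt_three n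
theorem u₁_sub_u₃_zpow_mem_right (n : ℤ) :
    ((u₁ K - u₃ K) ^ n, (u₁ K - u₂ K) ^ n) ∈ permSubring K W swapRight :=
  mono_sub_zpow_mem_permSubring swapRight ex_one_lt_three ex_one_lt_two n
theorem u₂_sub_u₁_zpow_mem_right (n : ℤ) :
    ((u₂ K - u₁ K) ^ n, (u₃ K - u₁ K) ^ n) ∈ permSubring K W swapRight :=
  mono_sub_zpow_mem_permSubring' swapRight ex_one_lt_two ex_one_lt_three n
theorem u₃_sub_u₁_zpow_mem_right (n : ℤ) :
    ((u₃ K - u₁ K) ^ n, (u₂ K - u₁ K) ^ n) ∈ permSubring K W swapRight :=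
  mono_sub_zpow_mem_permSubring' swapRight ex_one_lt_three ex_one_lt_two n

/-- The coefficient of `f F` at `γ`, as a function of the scalar `f`. -/
def pairing (F : HahnModule Exps K W) (γ : Exps) : HahnSeries Exps K →+ W where
  toFun f := hcoeff (f • F) γ
  map_zero' := by simp
  map_add' f g := by rw [add_smul, hcoeff_add]

theorem pairing_apply (F : HahnModule Exps K W) (γ : Exps) (f : HahnSeries Exps K) :
    pairing F γ f = hcoeff (f • F) γ := rfl

/-- The sum `∑ C(l, i) (-1)^i a_(P+l-i) (b_(Q+i) c)` is the truncated kernel in powers of `y - z`,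
paired with the terms of `[a(x), [b(y), c(z)]]`. In each word, `u₁, u₂, u₃` are the variables of the
first, second and third letter. -/
theorem sum_resProd_right (a b c : VertexOperator K W) (e : ℕ → VertexOperator K W) (l P Q : ℤ)
    (N : ℕ) (he : ∀ (i : ℕ) (s : ℤ) (w : W), fcoeff (e i) s w = resProd (Q + i) b c s w) (s : ℤ)
    (w : W) :
    ∑ i ∈ Finset.range N, binomCoeff l i • resProd (P + l - i) a (e i) s w =
      pairing (word a b c w) (ex (-1) (-1) s) (kernelRight l P Q N (u₁ K - u₃ K) (u₂ K - u₃ K)) -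
      pairing (word a c b w) (ex (-1) s (-1)) (kernelRight l P Q N (u₁ K - u₂ K) (u₃ K - u₂ K)) -
      pairing (word b c a w) (ex (-1) s (-1)) (kernelRight l P Q N (u₃ K - u₂ K) (u₁ K - u₂ K)) +
      pairing (word c b a w) (ex s (-1) (-1))
        (kernelRight l P Q N (u₃ K - u₁ K) (u₂ K - u₁ K)) := by
  simp only [kernelRight, map_sum, map_zsmul]
  rw [← Finset.sum_sub_distrib, ← Finset.sum_sub_distrib, ← Finset.sum_add_distrib]
  refine Finset.sum_congr rfl fun i _ => ?_
  rw [resProd_right a b c (e i) _ _ (he i), smul_add, smul_sub, smul_sub]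
  rfl

/-- The sum `∑ C(P, i) (a_(l+i) b)_(P+Q-i) c` is the truncated kernel in powers of `x - y`, paired
with the terms of `[[a(x), b(y)], c(z)]`. -/
theorem sum_resProd_left (a b c : VertexOperator K W) (e : ℕ → VertexOperator K W) (l P Q : ℤ)
    (N : ℕ) (he : ∀ (i : ℕ) (s : ℤ) (w : W), fcoeff (e i) s w = resProd (l + i) a b s w) (s : ℤ)
    (w : W) :
    ∑ i ∈ Finset.range N, (Ring.choose P i : ℤ) • resProd (P + Q - i) (e i) c s w =
      pairing (word a b c w) (ex (-1) (-1) s) (kernelDiag l P Q N (u₁ K - u₃ K) (u₂ K - u₃ K)) -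
      pairing (word b a c w) (ex (-1) (-1) s) (kernelDiag l P Q N (u₂ K - u₃ K) (u₁ K - u₃ K)) -
      pairing (word c a b w) (ex s (-1) (-1)) (kernelDiag l P Q N (u₂ K - u₁ K) (u₃ K - u₁ K)) +
      pairing (word c b a w) (ex s (-1) (-1)) (kernelDiag l P Q N (u₃ K - u₁ K) (u₂ K - u₁ K)) := by
  simp only [kernelDiag, map_sum, map_zsmul, sub_sub_sub_cancel_right]
  rw [← Finset.sum_sub_distrib, ← Finset.sum_sub_distrib, ← Finset.sum_add_distrib]
  refine Finset.sum_congr rfl fun i _ => ?_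
  rw [resProd_left a b c (e i) _ _ (he i), smul_add, smul_sub, smul_sub]
  rfl

/-- If `b` and `c` are mutually local, expanding the kernel in powers of `y - z` up to a high order
does not change its pairing with `a(x) [b(y), c(z)]`. -/
theorem pairing_kernel_sub_kernelRight {k : ℕ} {b c : VertexOperator K W} (h : LocalAt k b c)
    (a : VertexOperator K W) (l P Q : ℤ) (N : ℕ) (hN : k ≤ Q + N) (s : ℤ) (w : W) :
    pairing (word a b c w) (ex (-1) (-1) s) (kernel l P Q (u₁ K - u₃ K) (u₂ K - u₃ K) -
        kernelRight l P Q N (u₁ K - u₃ K) (u₂ K - u₃ K)) =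
      pairing (word a c b w) (ex (-1) s (-1)) (kernel l P Q (u₁ K - u₂ K) (u₃ K - u₂ K) -
        kernelRight l P Q N (u₁ K - u₂ K) (u₃ K - u₂ K)) := by
  obtain ⟨g, hg, e, e'⟩ := exists_kernel_sub_kernelRight (permSubring K W swapRight)
    (u₁_sub_u₃_ne_zero (K := K)) u₁_sub_u₂_ne_zero u₂_sub_u₃_ne_zero u₃_sub_u₂_ne_zero
    (by rw [sub_sub_sub_cancel_right]; exact u₁_sub_u₂_ne_zero)
    (by rw [sub_sub_sub_cancel_right]; exact u₁_sub_u₃_ne_zero) l P Q N u₁_sub_u₃_zpow_mem_right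
    (by simp only [sub_sub_sub_cancel_right]; exact u₁_sub_u₂_zpow_mem_right)
  exact h.hcoeff_swapRight a w hg hN e e' _ _ _

/-- The analogue of `pairing_kernel_sub_kernelRight` for `[b(y), c(z)] a(x)`. -/
theorem pairing_kernel_sub_kernelRight' {k : ℕ} {b c : VertexOperator K W} (h : LocalAt k b c)
    (a : VertexOperator K W) (l P Q : ℤ) (N : ℕ) (hN : k ≤ Q + N) (s : ℤ) (w : W) :
    pairing (word b c a w) (ex (-1) s (-1)) (kernel l P Q (u₃ K - u₂ K) (u₁ K - u₂ K) -
        kernelRight l P Q N (u₃ K - u₂ K) (u₁ K - u₂ K)) =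
      pairing (word c b a w) (ex s (-1) (-1)) (kernel l P Q (u₃ K - u₁ K) (u₂ K - u₁ K) -
        kernelRight l P Q N (u₃ K - u₁ K) (u₂ K - u₁ K)) := by
  obtain ⟨g, hg, e, e'⟩ := exists_kernel_sub_kernelRight (permSubring K W swapLeft)
    (u₃_sub_u₂_ne_zero (K := K)) u₃_sub_u₁_ne_zero u₁_sub_u₂_ne_zero u₂_sub_u₁_ne_zero
    (by rw [sub_sub_sub_cancel_right]; exact u₃_sub_u₁_ne_zero)
    (by rw [sub_sub_sub_cancel_right]; exact u₃_sub_u₂_ne_zero) l P Q N u₃_sub_u₂_zpow_mem_left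
    (by simp only [sub_sub_sub_cancel_right]; exact u₃_sub_u₁_zpow_mem_left)
  exact h.hcoeff_swapLeft a w hg hN e e' _ _ _

/-- If `a` and `b` are mutually local, expanding the kernel in powers of `x - y` up to a high order
does not change its pairing with `[a(x), b(y)] c(z)`. -/
theorem pairing_kernel_sub_kernelDiag {k : ℕ} {a b : VertexOperator K W} (h : LocalAt k a b)
    (c : VertexOperator K W) (l P Q : ℤ) (N : ℕ) (hN : k ≤ l + N) (s : ℤ) (w : W) :
    pairing (word a b c w) (ex (-1) (-1) s) (kernel l P Q (u₁ K - u₃ K) (u₂ K - u₃ K) -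
        kernelDiag l P Q N (u₁ K - u₃ K) (u₂ K - u₃ K)) =
      pairing (word b a c w) (ex (-1) (-1) s) (kernel l P Q (u₂ K - u₃ K) (u₁ K - u₃ K) -
        kernelDiag l P Q N (u₂ K - u₃ K) (u₁ K - u₃ K)) := by
  obtain ⟨g, hg, e, e'⟩ := exists_kernel_sub_kernelDiag (permSubring K W swapLeft)
    (u₁_sub_u₃_ne_zero (K := K)) u₂_sub_u₃_ne_zero u₂_sub_u₃_ne_zero u₁_sub_u₃_ne_zero
    (by rw [sub_sub_sub_cancel_right]; exact u₁_sub_u₂_ne_zero)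
    (by rw [sub_sub_sub_cancel_right]; exact u₂_sub_u₁_ne_zero) l P Q N u₁_sub_u₃_zpow_mem_left
    u₂_sub_u₃_zpow_mem_left
  rw [sub_sub_sub_cancel_right] at e e'
  exact h.hcoeff_swapLeft c w hg hN e e' _ _ _

/-- The analogue of `pairing_kernel_sub_kernelDiag` for `c(z) [a(x), b(y)]`. -/
theorem pairing_kernel_sub_kernelDiag' {k : ℕ} {a b : VertexOperator K W} (h : LocalAt k a b)
    (c : VertexOperator K W) (l P Q : ℤ) (N : ℕ) (hN : k ≤ l + N) (s : ℤ) (w : W) :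
    pairing (word c a b w) (ex s (-1) (-1)) (kernel l P Q (u₂ K - u₁ K) (u₃ K - u₁ K) -
        kernelDiag l P Q N (u₂ K - u₁ K) (u₃ K - u₁ K)) =
      pairing (word c b a w) (ex s (-1) (-1)) (kernel l P Q (u₃ K - u₁ K) (u₂ K - u₁ K) -
        kernelDiag l P Q N (u₃ K - u₁ K) (u₂ K - u₁ K)) := by
  obtain ⟨g, hg, e, e'⟩ := exists_kernel_sub_kernelDiag (permSubring K W swapRight)
    (u₂_sub_u₁_ne_zero (K := K)) u₃_sub_u₁_ne_zero u₃_sub_u₁_ne_zero u₂_sub_u₁_ne_zero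
    (by rw [sub_sub_sub_cancel_right]; exact u₂_sub_u₃_ne_zero)
    (by rw [sub_sub_sub_cancel_right]; exact u₃_sub_u₂_ne_zero) l P Q N u₂_sub_u₁_zpow_mem_right
    u₃_sub_u₁_zpow_mem_right
  rw [sub_sub_sub_cancel_right] at e e'
  exact h.hcoeff_swapRight c w hg hN e e' _ _ _

/-- The Borcherds identity for the residue products of three mutually local vertex operators.
Written in words, each of the three sums is a double commutator paired with a truncated expansion
of the kernel `(x - y)^l (x - z)^P (y - z)^Q`. By locality the kernel itself may be used, and then
the identity is the Jacobi identity `[a, [b, c]] - [b, [a, c]] = [[a, b], c]`. -/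
theorem resProd_borcherds {a b c : VertexOperator K W} {kab kac kbc : ℕ} (hab : LocalAt kab a b)
    (hac : LocalAt kac a c) (hbc : LocalAt kbc b c) (l P Q : ℤ) (N : ℕ) (hl : kab ≤ l + N)
    (hP : kac ≤ P + N) (hQ : kbc ≤ Q + N) (ab ac bc : ℕ → VertexOperator K W)
    (eab : ∀ (i : ℕ) (s : ℤ) (w : W), fcoeff (ab i) s w = resProd (l + i) a b s w)
    (eac : ∀ (i : ℕ) (s : ℤ) (w : W), fcoeff (ac i) s w = resProd (P + i) a c s w)
    (ebc : ∀ (i : ℕ) (s : ℤ) (w : W), fcoeff (bc i) s w = resProd (Q + i) b c s w)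
    (s : ℤ) (w : W) :
    ∑ i ∈ Finset.range N, binomCoeff l i • resProd (P + l - i) a (bc i) s w -
      ((Int.negOnePow l : ℤˣ) : ℤ) •
        ∑ i ∈ Finset.range N, binomCoeff l i • resProd (Q + l - i) b (ac i) s w =
    ∑ i ∈ Finset.range N, (Ring.choose P i : ℤ) • resProd (P + Q - i) (ab i) c s w := by
  rw [sum_resProd_right a b c bc l P Q N ebc, sum_resProd_right b a c ac l Q P N eac,
    sum_resProd_left a b c ab l P Q N eab]
  -- Interchanging `x` and `y` in the kernel costs the sign `(-1)^l` (`kernel_swap`).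
  have h1 := pairing_kernel_sub_kernelRight hbc a l P Q N hQ s w
  have h2 := pairing_kernel_sub_kernelRight' hbc a l P Q N hQ s w
  have h3 := congrArg (((Int.negOnePow l : ℤˣ) : ℤ) • ·)
    (pairing_kernel_sub_kernelRight hac b l Q P N hP s w)
  have h4 := congrArg (((Int.negOnePow l : ℤˣ) : ℤ) • ·)
    (pairing_kernel_sub_kernelRight' hac b l Q P N hP s w)
  have h5 := pairing_kernel_sub_kernelDiag hab c l P Q N hl s w
  have h6 := pairing_kernel_sub_kernelDiag' hab c l P Q N hl s w
  simp only [map_sub, smul_sub, ← map_zsmul, ← kernel_swap] at h1 h2 h3 h4 h5 h6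
  simp only [smul_sub, smul_add, ← map_zsmul]
  linear_combination (norm := abel1) h3 - h1 + h2 - h4 + h5 - h6

end Borcherds

/-! ### The coefficients of `Y_ℰ` as residue products -/

section ResidueFormula

theorem binomCoeff_neg_one_sub (i j : ℕ) : binomCoeff (-1 - i) j = ((i + j).choose i : ℕ) := by
  have h := binomCoeff_delta (-1 - i - j) j
  rw [sub_add_cancel, show (-(-1 - i - j : ℤ) - 1) = ((i + j : ℕ) : ℤ) by push_cast; ring,
    Ring.choose_natCast] at h
  rw [h, Nat.choose_symm_add]

/-- The two expansions of `(x - y)^(-i-1)` differ by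
`∑_p C(p, i) x^(-p-1) y^(p-i)`, an `i`-th divided derivative of the formal delta function; its
product with a series `X(x, y)` that is truncated in both variables is obtained from `X` by the
substitution `x = y + z`. -/
theorem expandL_sub_expandR {M : Type*} [AddCommGroup M] {X : ℤ → ℤ → M} {N : ℤ}
    (hX : ∀ p q, p < N ∨ q < N → X p q = 0) (i : ℕ) (q : ℤ) :
    expandL (-1 - i) X (-1) q - expandR (-1 - i) X (-1) q =
      ∑ᶠ p : ℤ, Ring.choose p i • X p (q + i - p) := by
  have fin : (Function.support fun p : ℤ => Ring.choose p i • X p (q + i - p)).Finite := by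
    refine (Set.finite_Icc N (q + i - N)).subset fun p hp => ?_
    by_contra hc
    apply hp
    simp only [Set.mem_Icc, not_and_or, not_le] at hc
    simp only
    rw [hX p _ (by omega), smul_zero]
  rw [finsum_int_eq_add _ fin, finsum_nat_eq_finsum_add
    (fun n : ℕ => Ring.choose (n : ℤ) i • X n (q + i - n)) _ i, sub_eq_add_neg]
  · congr 1
    · rw [expandL]
      refine finsum_congr fun j => ?_
      rw [binomCoeff_neg_one_sub, Ring.choose_natCast, add_comm j i]
      congr 2 <;> push_cast <;> ring
    · rw [expandR, ← neg_smul,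
        smul_finsum' _ (expandR_finite ⟨N, fun p hp q => hX p q (Or.inl hp)⟩ _ _ _ _)]
      refine finsum_congr fun j => ?_
      have e := binomCoeff_delta j i
      rw [show (-(j : ℤ) - 1) = -1 - j by ring] at e
      rw [← e, binomCoeff_neg_one_sub, binomCoeff, ← Nat.cast_add, Ring.choose_natCast, smul_smul,
        add_comm j i]
      congr 2
      · have : -((Int.negOnePow (-1 - i) : ℤˣ) : ℤ) = (-1) ^ i := by
          rw [Int.negOnePow_sub, Int.negOnePow_neg, Int.negOnePow_one]
          simp [Int.negOnePow_def]
        rw [this]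
      · ring
  · intro n hn
    rw [Ring.choose_natCast, Nat.choose_eq_zero_of_lt hn]
    simp
  · exact fin.preimage Nat.cast_injective.injOn

variable {K : Type*} [Field K] {r : ℕ} {W : Type*} [AddCommGroup W] [Module K W]

/-- The coefficient of `x^m`, `x = (x₁, …, x_r)`, in `a(x₀, x)`: a vertex operator in `x₀`. -/
def component (a : fieldSpace K r W) (m : Fin r → ℤ) : VertexOperator K W :=
  VertexOperator.of_coeff (fun p => coeff a p m) fun w => by
    obtain ⟨N, hN⟩ := a.2 w
    refine ⟨N, fun p hp => ?_⟩
    by_contra hc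
    exact hp (hN p (not_le.1 hc) m)

theorem fcoeff_component (a : fieldSpace K r W) (m : Fin r → ℤ) (p : ℤ) :
    fcoeff (component a m) p = coeff a p m := rfl

variable (K W) in
/-- The constant vertex operator `1_W`, which fills the third place in a word with two letters. -/
def idOp : VertexOperator K W := component (idField K 0 W) 0

theorem fcoeff_idOp_zero (w : W) : fcoeff (idOp K W) 0 w = w := by
  simp [idOp, fcoeff_component, coeff, idField]

theorem hcoeff_u₁_sub_u₂_zpow_smul (l : ℤ) (F : HahnModule Exps K W) (p q s : ℤ) :
    hcoeff ((u₁ K - u₂ K) ^ l • F) (ex p q s) =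
      expandL l (fun p q => hcoeff F (ex p q s)) p q := by
  rw [ex_eq_one_two, u₁, u₂, ← expandL_hcoeff ex_one_lt_two]
  simp only [← ex_eq_one_two]

theorem hcoeff_u₂_sub_u₁_zpow_smul (l : ℤ) (F : HahnModule Exps K W) (p q s : ℤ) :
    hcoeff ((u₂ K - u₁ K) ^ l • F) (ex q p s) =
      expandR l (fun p q => hcoeff F (ex q p s)) p q := by
  rw [ex_eq_two_one, u₁, u₂, ← expandR_hcoeff ex_one_lt_two]
  simp only [← ex_eq_two_one]

theorem resProd_eq_hcoeff (l : ℤ) (a b : VertexOperator K W) (q : ℤ) (w : W) :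
    resProd l a b q w =
      hcoeff ((u₁ K - u₂ K) ^ l • word a b (idOp K W) w) (ex (-1) q 0) -
      hcoeff ((u₂ K - u₁ K) ^ l • word b a (idOp K W) w) (ex q (-1) 0) := by
  rw [hcoeff_u₁_sub_u₂_zpow_smul, hcoeff_u₂_sub_u₁_zpow_smul]
  simp only [hcoeff_word, fcoeff_idOp_zero]
  rfl

/-- The Borcherds identity for the action on a vector of two mutually local vertex operators and
their residue products. -/
theorem expandL_sub_expandR_eq_sum_resProd {k : ℕ} {a b : VertexOperator K W} (h : LocalAt k a b)
    (l p q : ℤ) (N : ℕ) (hN : k ≤ l + N) (w : W) :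
    expandL l (fun p q => fcoeff a p (fcoeff b q w)) p q -
      expandR l (fun p q => fcoeff b q (fcoeff a p w)) p q =
    ∑ i ∈ Finset.range N, (Ring.choose (-p - 1) i : ℤ) •
      resProd (l + i) a b (q + p + i + 1) w := by
  have h1 : expandL l (fun p q => fcoeff a p (fcoeff b q w)) p q =
      pairing (word a b (idOp K W) w) (ex (-1) (-1) 0)
        (kernel l (-p - 1) (-q - 1) (u₁ K) (u₂ K)) := by
    rw [pairing_apply, kernel, mul_comm, mul_smul, mul_smul]
    conv_rhs => rw [u₁, u₂, mono_zpow, mono_zpow, hcoeff_mono_smul, hcoeff_mono_smul, ex_zsmul,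
      ex_zsmul, ex_sub, ex_sub, ← u₁, ← u₂, hcoeff_u₁_sub_u₂_zpow_smul]
    simp only [mul_zero, sub_zero, mul_one, hcoeff_word, fcoeff_idOp_zero]
    congr 1 <;> ring
  have h2 : expandR l (fun p q => fcoeff b q (fcoeff a p w)) p q =
      pairing (word b a (idOp K W) w) (ex (-1) (-1) 0)
        (kernel l (-p - 1) (-q - 1) (u₂ K) (u₁ K)) := by
    rw [pairing_apply, kernel, mul_comm, mul_smul, mul_smul]
    conv_rhs => rw [u₁, u₂, mono_zpow, mono_zpow, hcoeff_mono_smul, hcoeff_mono_smul, ex_zsmul,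
      ex_zsmul, ex_sub, ex_sub, ← u₁, ← u₂, hcoeff_u₂_sub_u₁_zpow_smul]
    simp only [mul_zero, sub_zero, mul_one, hcoeff_word, fcoeff_idOp_zero]
    congr 1 <;> ring
  have h3 : ∑ i ∈ Finset.range N, (Ring.choose (-p - 1) i : ℤ) •
      resProd (l + i) a b (q + p + i + 1) w =
      pairing (word a b (idOp K W) w) (ex (-1) (-1) 0)
        (kernelDiag l (-p - 1) (-q - 1) N (u₁ K) (u₂ K)) -
      pairing (word b a (idOp K W) w) (ex (-1) (-1) 0)
        (kernelDiag l (-p - 1) (-q - 1) N (u₂ K) (u₁ K)) := by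
    simp only [kernelDiag, map_sum, map_zsmul]
    rw [← Finset.sum_sub_distrib]
    refine Finset.sum_congr rfl fun i _ => ?_
    rw [← smul_sub, resProd_eq_hcoeff, pairing_apply, pairing_apply, mul_comm (_ ^ (l + i)),
      mul_comm (_ ^ (l + i)), mul_smul, mul_smul]
    conv_rhs => rw [u₁, u₂, mono_zpow, mono_zpow, hcoeff_mono_smul, hcoeff_mono_smul, ex_zsmul,
      ex_zsmul, ex_sub, ex_sub, ← u₁, ← u₂]
    simp only [mul_zero, sub_zero, mul_one]
    rw [show (-1 - (-p - 1 + (-q - 1) - (i : ℤ))) = q + p + i + 1 by ring]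
  obtain ⟨g, hg, e, e'⟩ := exists_kernel_sub_kernelDiag (permSubring K W swapLeft)
    (mono_ne_zero (K := K) (ex 1 0 0)) (mono_ne_zero (ex 0 1 0)) (mono_ne_zero (ex 0 1 0))
    (mono_ne_zero (ex 1 0 0)) u₁_sub_u₂_ne_zero u₂_sub_u₁_ne_zero l (-p - 1) (-q - 1) N
    (mono_zpow_mem_permSubring swapLeft _) (mono_zpow_mem_permSubring swapLeft _)
  have h4 := h.hcoeff_swapLeft (idOp K W) w hg hN e e' (-1) (-1) 0
  rw [← pairing_apply, ← pairing_apply, map_sub, map_sub] at h4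
  rw [h1, h2, h3, sub_eq_sub_iff_sub_eq_sub]
  exact h4

theorem MutuallyLocal.exists_localAt {a b : fieldSpace K r W}
    (h : MutuallyLocal (a : FormalDist K r W) b) :
    ∃ k : ℕ, ∀ m n, LocalAt k (component a m) (component b n) :=
  h.imp fun _ hk m n p q => hk m n p q

theorem compatibleWith_of_localAt {a b : fieldSpace K r W} {k : ℕ}
    (h : ∀ m n, LocalAt k (component a m) (component b n)) : CompatibleWith k a b := by
  intro w
  obtain ⟨N, hN⟩ := a.2 w
  obtain ⟨M, hM⟩ := b.2 w
  have app : ∀ (F : ℤ → ℤ → Module.End K W) p q,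
      mulPow k F p q w = mulPow k (fun p q => F p q w) p q := fun F p q =>
    map_mulPow (LinearMap.applyₗ w : Module.End K W →ₗ[K] W).toAddMonoidHom k F p q
  refine ⟨min N M, fun m n p q hpq => ?_⟩
  rcases hpq with hp | hq
  · rw [show mulPow k (fun p q => coeff a p m * coeff b q n) p q =
      mulPow k (fun p q => coeff b q n * coeff a p m) p q from h m n p q, app]
    refine Finset.sum_eq_zero fun i hi => ?_
    have : i ≤ k := Nat.lt_succ_iff.1 (Finset.mem_range.1 hi)
    simp only [Module.End.mul_apply]
    rw [show coeff a (p - k + i) m w = 0 from hN _ (by omega) m, map_zero,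
      smul_zero]
  · rw [app]
    refine Finset.sum_eq_zero fun i _ => ?_
    simp only [Module.End.mul_apply]
    rw [show coeff b (q - i) n w = 0 from hM _ (by omega) n, map_zero,
      smul_zero]

theorem YE_eq_substShift {a b : fieldSpace K r W} {k : ℕ} (h : CompatibleWith k a b) (t : ℤ)
    (m : Fin r → ℤ) : YE a b t m = substShift h t m := by
  rw [YE, dif_pos ⟨k, h⟩]
  exact substShift_indep _ _ t m

theorem YE_eq_zero {a b : fieldSpace K r W} {k : ℕ} (h : CompatibleWith k a b) {t : ℤ}
    (ht : t + k < 0) (m : Fin r → ℤ) : YE a b t m = 0 := by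
  rw [YE_eq_substShift h, substShift, if_neg (by omega)]

/-- The components of `Y_ℰ(a; z₀, z) b` are the residue products of the components of `a`
and `b`. -/
theorem coeff_YE {a b : fieldSpace K r W} (h : MutuallyLocal (a : FormalDist K r W) b) (t : ℤ)
    (m n : Fin r → ℤ) (q : ℤ) (w : W) :
    coeff (YE a b t m) q n w = resProd (-t - 1) (component a m) (component b (n - m)) q w := by
  obtain ⟨k, hk⟩ := h.exists_localAt
  have hc := compatibleWith_of_localAt hk
  have hloc := hk m (n - m)
  rw [YE_eq_substShift hc, resProd_eq_hcoeff]
  rcases lt_or_ge (t + k) 0 with ht | ht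
  · rw [substShift, if_neg (by omega), hloc.hcoeff_swapLeft (idOp K W) w (g := 1) (one_mem _)
      (n := -t - 1) (by omega) (mul_one _).symm (mul_one _).symm, sub_self]
    rfl
  · obtain ⟨i, hi⟩ : ∃ i : ℕ, t + k = i := ⟨(t + k).toNat, by omega⟩
    obtain ⟨N, hN⟩ := hc w
    have hl : -t - 1 = (-1 - i) + (k : ℤ) := by omega
    have hX : ∀ p q : ℤ, hcoeff ((u₁ K - u₂ K) ^ k • word (component a m) (component b (n - m))
        (idOp K W) w) (ex p q 0) = substSeries k a b m n p q w := by
      intro p q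
      rw [ex_eq_one_two, u₁, u₂, hcoeff_sub_pow_smul]
      simp only [← ex_eq_one_two, hcoeff_word, fcoeff_idOp_zero]
      exact (map_mulPow (LinearMap.applyₗ w : Module.End K W →ₗ[K] W).toAddMonoidHom k
        (fun p q => coeff a p m * coeff b q (n - m)) p q).symm
    have hX' : ∀ p q : ℤ, hcoeff ((u₂ K - u₁ K) ^ k • word (component b (n - m)) (component a m)
        (idOp K W) w) (ex q p 0) = substSeries k a b m n p q w := by
      intro p q
      rw [← hX, ← hloc.permuted_left, swapLeft_ex]
    rw [substShift, if_pos ht, show (t + k).toNat = i by omega, hl, zpow_add₀ u₁_sub_u₂_ne_zero,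
      zpow_add₀ u₂_sub_u₁_ne_zero, zpow_natCast, zpow_natCast, mul_smul, mul_smul,
      hcoeff_u₁_sub_u₂_zpow_smul, hcoeff_u₂_sub_u₁_zpow_smul]
    simp only [hX, hX']
    rw [expandL_sub_expandR (N := N)]
    · rfl
    · intro p q hpq
      exact hN m (n - m) p q hpq

end ResidueFormula

/-! ### Derivations and residue products -/

section Derivations

theorem succ_mul_binomCoeff_succ (l : ℤ) (i : ℕ) :
    (i + 1) * binomCoeff l (i + 1) = -l * binomCoeff (l - 1) i := by
  have h := Ring.choose_smul_choose l (n := i + 1) (k := 1) (by omega)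
  rw [Nat.choose_one_right, Ring.choose_one_right, add_tsub_cancel_right, nsmul_eq_mul] at h
  push_cast at h
  rw [binomCoeff, binomCoeff, pow_succ]
  linear_combination (-(-1) ^ i : ℤ) * h

theorem sub_mul_binomCoeff (l : ℤ) (i : ℕ) :
    (l - i) * binomCoeff l i = l * binomCoeff (l - 1) i := by
  rcases i with _ | i
  · simp [binomCoeff_zero_right]
  · have h := succ_mul_binomCoeff_succ l i
    have h' := binomCoeff_succ (l - 1) i
    rw [sub_add_cancel] at h'
    push_cast
    linear_combination -h + l * h'

variable {M : Type*} [AddCommGroup M]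

/-- `∂/∂x ((x - y)^l F) = (x - y)^l ∂F/∂x + l (x - y)^(l-1) F`. -/
theorem expandL_deriv_left {F : ℤ → ℤ → M} (hF : ∃ N : ℤ, ∀ p, ∀ q < N, F p q = 0) (l p q : ℤ) :
    (p + 1) • expandL l F (p + 1) q =
      expandL l (fun p q => (p + 1) • F (p + 1) q) p q + l • expandL (l - 1) F p q := by
  have hF' : ∃ N : ℤ, ∀ p, ∀ q < N, (p + 1) • F (p + 1) q = 0 :=
    hF.imp fun N hN p q hq => by rw [hN _ q hq, smul_zero]
  rw [expandL, expandL, expandL, smul_finsum' _ (expandL_finite hF _ _ _ _),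
    smul_finsum' _ (expandL_finite hF _ _ _ _), ← finsum_add_distrib]
  · refine finsum_congr fun i => ?_
    rw [show p - l + i + 1 = p + 1 - l + i by ring, show p - (l - 1) + i = p + 1 - l + i by ring,
      smul_smul, smul_smul, smul_smul, ← add_smul, ← sub_mul_binomCoeff]
    congr 1
    ring
  · exact expandL_finite hF' _ l p q
  · have := expandL_finite hF (fun i => l * binomCoeff (l - 1) i) (l - 1) p q
    simp only [mul_smul] at this
    exact this

/-- `∂/∂y ((x - y)^l F) = (x - y)^l ∂F/∂y - l (x - y)^(l-1) F`. -/
theorem expandL_deriv_right {F : ℤ → ℤ → M} (hF : ∃ N : ℤ, ∀ p, ∀ q < N, F p q = 0) (l p q : ℤ) :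
    (q + 1) • expandL l F p (q + 1) =
      expandL l (fun p q => (q + 1) • F p (q + 1)) p q - l • expandL (l - 1) F p q := by
  have hF' : ∃ N : ℤ, ∀ p, ∀ q < N, (q + 1) • F p (q + 1) = 0 := by
    obtain ⟨N, hN⟩ := hF
    exact ⟨N - 1, fun p q hq => by rw [hN _ _ (by omega), smul_zero]⟩
  have f1 : (Function.support fun i : ℕ =>
      ((i : ℤ) * binomCoeff l i) • F (p - l + i) (q + 1 - i)).Finite :=
    expandL_finite hF (fun i => i * binomCoeff l i) l p (q + 1)
  have e1 : -(l • expandL (l - 1) F p q) =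
      ∑ᶠ i : ℕ, ((i : ℤ) * binomCoeff l i) • F (p - l + i) (q + 1 - i) := by
    rw [finsum_nat_eq_add _ f1, expandL, ← neg_smul, smul_finsum' _ (expandL_finite hF _ _ _ _)]
    simp only [Nat.cast_zero, zero_mul, zero_smul, zero_add]
    refine finsum_congr fun i => ?_
    push_cast
    rw [succ_mul_binomCoeff_succ, smul_smul]
    congr 2 <;> ring
  rw [sub_eq_add_neg, e1, expandL, expandL, smul_finsum' _ (expandL_finite hF _ _ _ _),
    ← finsum_add_distrib (expandL_finite hF' _ l p q) f1]
  refine finsum_congr fun i => ?_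
  rw [show q - i + 1 = q + 1 - i by ring, smul_smul, smul_smul, ← add_smul]
  congr 1
  ring

theorem expandR_eq_expandL (l : ℤ) (F : ℤ → ℤ → M) (p q : ℤ) :
    expandR l F p q = ((Int.negOnePow l : ℤˣ) : ℤ) • expandL l (fun q p => F p q) q p := rfl

theorem negOnePow_sub_one (l : ℤ) :
    ((Int.negOnePow (l - 1) : ℤˣ) : ℤ) = -((Int.negOnePow l : ℤˣ) : ℤ) := by
  rw [Int.negOnePow_sub, Int.negOnePow_one]; simp

theorem expandR_deriv_left {F : ℤ → ℤ → M} (hF : ∃ N : ℤ, ∀ p < N, ∀ q, F p q = 0) (l p q : ℤ) :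
    (p + 1) • expandR l F (p + 1) q =
      expandR l (fun p q => (p + 1) • F (p + 1) q) p q + l • expandR (l - 1) F p q := by
  have h := expandL_deriv_right (F := fun q p => F p q)
    (hF.imp fun N hN q p hp => hN p hp q) l q p
  simp only [expandR_eq_expandL, negOnePow_sub_one]
  rw [smul_comm, h, smul_sub, neg_smul, smul_neg, smul_comm l, sub_eq_add_neg]

theorem expandR_deriv_right {F : ℤ → ℤ → M} (hF : ∃ N : ℤ, ∀ p < N, ∀ q, F p q = 0) (l p q : ℤ) :
    (q + 1) • expandR l F p (q + 1) =
      expandR l (fun p q => (q + 1) • F p (q + 1)) p q - l • expandR (l - 1) F p q := by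
  have h := expandL_deriv_left (F := fun q p => F p q)
    (hF.imp fun N hN q p hp => hN p hp q) l q p
  simp only [expandR_eq_expandL, negOnePow_sub_one]
  rw [smul_comm, h, smul_add, neg_smul, smul_neg, smul_comm l, sub_neg_eq_add]

variable {K : Type*} [Field K] {W : Type*} [AddCommGroup W] [Module K W]

theorem map_resProd {a b a' b' : VertexOperator K W} (f : W →+ W) {w : W}
    (h : ∀ p q, fcoeff a' p (fcoeff b' q w) = f (fcoeff a p (fcoeff b q w)))
    (h' : ∀ p q, fcoeff b' q (fcoeff a' p w) = f (fcoeff b q (fcoeff a p w))) (l q : ℤ) :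
    resProd l a' b' q w = f (resProd l a b q w) := by
  rw [resProd, resProd, map_sub, map_expandL f (bdd_left a b w), map_expandR f (bdd_right a b w)]
  simp only [h, h']

theorem resProd_add {a b a₁ b₁ a₂ b₂ : VertexOperator K W} {w : W}
    (h : ∀ p q, fcoeff a p (fcoeff b q w) =
      fcoeff a₁ p (fcoeff b₁ q w) + fcoeff a₂ p (fcoeff b₂ q w))
    (h' : ∀ p q, fcoeff b q (fcoeff a p w) =
      fcoeff b₁ q (fcoeff a₁ p w) + fcoeff b₂ q (fcoeff a₂ p w)) (l q : ℤ) :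
    resProd l a b q w = resProd l a₁ b₁ q w + resProd l a₂ b₂ q w := by
  simp only [resProd, h, h']
  rw [expandL_add (bdd_left a₁ b₁ w) (bdd_left a₂ b₂ w),
    expandR_add (bdd_right a₁ b₁ w) (bdd_right a₂ b₂ w)]
  abel

/-- `(∂a)_(l) b = -l a_(l-1) b`. -/
theorem resProd_deriv_left {a a' : VertexOperator K W} (b : VertexOperator K W)
    (h : ∀ p, fcoeff a' p = (p + 1) • fcoeff a (p + 1)) (l q : ℤ) (w : W) :
    resProd l a' b q w = -l • resProd (l - 1) a b q w := by
  have h1 := expandL_deriv_left (bdd_left a b w) l (-1) q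
  have h2 := expandR_deriv_left (bdd_right a b w) l (-1) q
  rw [neg_add_cancel, zero_smul] at h1 h2
  simp only [resProd, h, LinearMap.smul_apply, map_zsmul]
  rw [eq_neg_of_add_eq_zero_left h1.symm, eq_neg_of_add_eq_zero_left h2.symm, neg_smul, smul_sub]
  abel

/-- `∂(a_(l) b) = (∂a)_(l) b + a_(l) (∂b)`. -/
theorem resProd_deriv {a b a' b' : VertexOperator K W}
    (h : ∀ p, fcoeff a' p = (p + 1) • fcoeff a (p + 1))
    (h' : ∀ p, fcoeff b' p = (p + 1) • fcoeff b (p + 1)) (l q : ℤ) (w : W) :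
    (q + 1) • resProd l a b (q + 1) w = resProd l a' b q w + resProd l a b' q w := by
  rw [resProd_deriv_left b h, resProd, smul_sub, expandL_deriv_right (bdd_left a b w),
    expandR_deriv_right (bdd_right a b w)]
  simp only [resProd, h', LinearMap.smul_apply, map_zsmul]
  rw [neg_smul, smul_sub]
  abel

end Derivations

/-! ### The identity field and derivations in `ℰ(W, r)` -/

section Algebra

variable {K : Type*} [Field K] {r : ℕ} {W : Type*} [AddCommGroup W] [Module K W]

theorem coeff_add (a b : fieldSpace K r W) (p : ℤ) (m : Fin r → ℤ) :
    coeff (a + b) p m = coeff a p m + coeff b p m := rfl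

theorem coeff_zsmul (c : ℤ) (a : fieldSpace K r W) (p : ℤ) (m : Fin r → ℤ) :
    coeff (c • a) p m = c • coeff a p m := rfl

theorem coeff_derivZero (a : fieldSpace K r W) (p : ℤ) (m : Fin r → ℤ) :
    coeff (derivZero K r W a) p m = (p + 1) • coeff a (p + 1) m := rfl

theorem coeff_eulerDeriv (j : Fin r) (a : fieldSpace K r W) (p : ℤ) (m : Fin r → ℤ) :
    coeff (eulerDeriv K r W j a) p m = m j • coeff a p m := rfl

theorem fieldSpace_ext {a b : fieldSpace K r W} (h : ∀ p m w, coeff a p m w = coeff b p m w) :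
    a = b :=
  Subtype.ext (funext fun p => funext fun m => LinearMap.ext fun w => h p m w)

theorem coeff_idField (p : ℤ) (m : Fin r → ℤ) (w : W) :
    coeff (idField K r W) p m w = if p = 0 ∧ m = 0 then w else 0 := by
  simp only [coeff, idField]
  split_ifs <;> rfl

theorem compatibleWith_idField_left (b : fieldSpace K r W) :
    CompatibleWith 0 (idField K r W) b := by
  intro w
  obtain ⟨N, hN⟩ := b.2 w
  refine ⟨min 0 N, fun m n p q hpq => ?_⟩
  simp only [mulPow, zero_add, Finset.sum_range_one, binomCoeff_zero_right, one_smul, Nat.cast_zero,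
    sub_zero, add_zero, Module.End.mul_apply]
  rcases hpq with hp | hq
  · rw [coeff_idField, if_neg (by omega)]
  · rw [show coeff b q n w = 0 from hN _ (by omega) n, map_zero]

theorem compatibleWith_idField_right (a : fieldSpace K r W) :
    CompatibleWith 0 a (idField K r W) := by
  intro w
  obtain ⟨N, hN⟩ := a.2 w
  refine ⟨min 0 N, fun m n p q hpq => ?_⟩
  simp only [mulPow, zero_add, Finset.sum_range_one, binomCoeff_zero_right, one_smul, Nat.cast_zero,
    sub_zero, add_zero, Module.End.mul_apply, coeff_idField]
  split_ifs with h
  · exact hN _ (by omega) m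
  · rw [map_zero]

theorem YE_idField_left (b : fieldSpace K r W) (t : ℤ) (m : Fin r → ℤ) :
    YE (idField K r W) b t m = if t = 0 ∧ m = 0 then b else 0 := by
  rw [YE_eq_substShift (compatibleWith_idField_left b), substShift, Nat.cast_zero, add_zero]
  rcases lt_or_ge t 0 with ht | ht
  · rw [if_neg (by omega), if_neg (by omega)]
  obtain ⟨i, rfl⟩ := Int.eq_ofNat_of_zero_le ht
  rw [if_pos ht, Int.toNat_natCast]
  refine fieldSpace_ext fun s n w => ?_
  change substCoeff 0 (idField K r W) b m i s n w = _
  have e : ∀ p q, substSeries 0 (idField K r W) b m n p q w =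
      if p = 0 ∧ m = 0 then coeff b q (n - m) w else 0 := by
    intro p q
    simp only [substSeries, mulPow, zero_add, Finset.sum_range_one, binomCoeff_zero_right, one_smul,
      Nat.cast_zero, sub_zero, add_zero, Module.End.mul_apply, coeff_idField]
  rw [substCoeff, finsum_eq_single _ (0 : ℤ) fun p hp => by
    rw [e, if_neg (by simp [hp]), smul_zero], e]
  rcases i with _ | i
  · by_cases hm : m = 0
    · subst hm; simp
    · simp only [hm, and_false, if_false, smul_zero]; rfl
  · rw [Ring.choose_zero_succ, zero_smul, if_neg (by omega)]
    rfl

theorem derivZero_idField : derivZero K r W (idField K r W) = 0 := by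
  refine fieldSpace_ext fun p m w => ?_
  rw [coeff_derivZero, LinearMap.smul_apply, coeff_idField]
  split_ifs with h
  · rw [h.1, zero_smul]; rfl
  · rw [smul_zero]; rfl

theorem eulerDeriv_idField (j : Fin r) : eulerDeriv K r W j (idField K r W) = 0 := by
  refine fieldSpace_ext fun p m w => ?_
  rw [coeff_eulerDeriv, LinearMap.smul_apply, coeff_idField]
  split_ifs with h
  · rw [h.2, Pi.zero_apply, zero_smul]; rfl
  · rw [smul_zero]; rfl

section YE

variable {a b a' b' : fieldSpace K r W}

theorem YE_derivZero_left (h : MutuallyLocal (a : FormalDist K r W) b)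
    (h' : MutuallyLocal (derivZero K r W a : FormalDist K r W) b) (t : ℤ) (m : Fin r → ℤ) :
    YE (derivZero K r W a) b t m = (t + 1) • YE a b (t + 1) m := by
  refine fieldSpace_ext fun q n w => ?_
  rw [coeff_zsmul, LinearMap.smul_apply, coeff_YE h, coeff_YE h',
    resProd_deriv_left (a := component a m) _ fun p => rfl]
  congr 2 <;> ring

theorem derivZero_YE (h : MutuallyLocal (a : FormalDist K r W) b)
    (h₁ : MutuallyLocal (derivZero K r W a : FormalDist K r W) b)
    (h₂ : MutuallyLocal (a : FormalDist K r W) (derivZero K r W b)) (t : ℤ) (m : Fin r → ℤ) :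
    derivZero K r W (YE a b t m) = YE (derivZero K r W a) b t m + YE a (derivZero K r W b) t m := by
  refine fieldSpace_ext fun q n w => ?_
  rw [coeff_derivZero, LinearMap.smul_apply, coeff_add, LinearMap.add_apply, coeff_YE h,
    coeff_YE h₁, coeff_YE h₂]
  exact resProd_deriv (fun p => rfl) (fun p => rfl) _ _ _

theorem YE_eulerDeriv_left (j : Fin r) (h : MutuallyLocal (a : FormalDist K r W) b)
    (h' : MutuallyLocal (eulerDeriv K r W j a : FormalDist K r W) b) (t : ℤ) (m : Fin r → ℤ) :
    YE (eulerDeriv K r W j a) b t m = m j • YE a b t m := by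
  refine fieldSpace_ext fun q n w => ?_
  rw [coeff_zsmul, LinearMap.smul_apply, coeff_YE h, coeff_YE h']
  exact map_resProd (a := component a m) (a' := component (eulerDeriv K r W j a) m)
    (b := component b (n - m)) (zsmulAddGroupHom (m j)) (fun p q => rfl)
    (fun p q => map_zsmul (coeff b q (n - m)) _ _) _ _

theorem eulerDeriv_YE (j : Fin r) (h : MutuallyLocal (a : FormalDist K r W) b)
    (h₁ : MutuallyLocal (eulerDeriv K r W j a : FormalDist K r W) b)
    (h₂ : MutuallyLocal (a : FormalDist K r W) (eulerDeriv K r W j b)) (t : ℤ) (m : Fin r → ℤ) :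
    eulerDeriv K r W j (YE a b t m) =
      YE (eulerDeriv K r W j a) b t m + YE a (eulerDeriv K r W j b) t m := by
  refine fieldSpace_ext fun q n w => ?_
  have e : coeff (YE a (eulerDeriv K r W j b) t m) q n w =
      (n - m) j • coeff (YE a b t m) q n w := by
    rw [coeff_YE h, coeff_YE h₂]
    exact map_resProd (a := component a m) (b := component b (n - m))
      (b' := component (eulerDeriv K r W j b) (n - m)) (zsmulAddGroupHom ((n - m) j))
      (fun p q => map_zsmul (coeff a p m) _ _) (fun p q => rfl) _ _
  rw [YE_eulerDeriv_left j h h₁, coeff_eulerDeriv, LinearMap.smul_apply, coeff_add,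
    LinearMap.add_apply, e, coeff_zsmul, LinearMap.smul_apply, ← add_smul, Pi.sub_apply,
    add_sub_cancel]

end YE

/-! ### The Jacobi identity for an embedding into `ℰ(W, r)` -/

theorem map_finsum_zsmul {M M' : Type*} [AddCommGroup M] [AddCommGroup M'] (f : M →+ M')
    (c : ℕ → ℤ) (x : ℕ → M) (N : ℕ) (hN : ∀ i ≥ N, x i = 0) :
    f (∑ᶠ i, c i • x i) = ∑ i ∈ Finset.range N, c i • f (x i) := by
  rw [finsum_nat_eq_sum_range _ N fun i hi => by rw [hN i hi, smul_zero], map_sum]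
  simp only [map_zsmul]

section MapJacobi

variable {U : Type*} [AddCommGroup U] [Module K U] {M : Type*} [AddCommGroup M] (f : U →+ M)
  (l p q : ℤ) (m n : Fin r → ℤ) (N : ℕ)

theorem map_jacobiTerm₁ (A B : fieldSpace K r U) (c : U)
    (hN : ∀ i : ℕ, i ≥ N → coeff B (q - i) (n - m) c = 0) :
    f (jacobiTerm₁ A B c l p q m n) = ∑ i ∈ Finset.range N,
      binomCoeff l i • f (coeff A (p - l + i) m (coeff B (q - i) (n - m) c)) :=
  map_finsum_zsmul _ _ _ N fun i hi => by rw [hN i hi, map_zero]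

theorem map_jacobiTerm₂ (A B : fieldSpace K r U) (c : U)
    (hN : ∀ i : ℕ, i ≥ N → coeff A (p - i) m c = 0) :
    f (jacobiTerm₂ A B c l p q m n) = ((Int.negOnePow l : ℤˣ) : ℤ) • ∑ i ∈ Finset.range N,
      binomCoeff l i • f (coeff B (q - l + i) (n - m) (coeff A (p - i) m c)) := by
  rw [jacobiTerm₂, map_zsmul]
  exact congrArg _ (map_finsum_zsmul _ _ _ N fun i hi => by rw [hN i hi, map_zero])

theorem map_jacobiTerm₃ (Y : U →ₗ[K] fieldSpace K r U) (a b c : U)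
    (hN : ∀ i : ℕ, i ≥ N → coeff (Y a) (-l - 1 - i) m b = 0) :
    f (jacobiTerm₃ Y Y a b c l p q m n) = ∑ i ∈ Finset.range N, (Ring.choose (-p - 1) i : ℤ) •
      f (coeff (Y (coeff (Y a) (-l - 1 - i) m b)) (q + (p + i) + 1) n c) := by
  simp only [← binomCoeff_delta]
  exact map_finsum_zsmul _ _ _ N fun i hi => by rw [hN i hi, map_zero]; rfl

end MapJacobi

/-- If `ι` embeds `U` into `ℰ(W, r)` with pairwise local image and intertwines `Y` with `Y_ℰ`, then
`Y` satisfies the Jacobi identity: its components, evaluated on vectors of `W`, are instances of the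
Borcherds identity for residue products. -/
theorem jacobiIdentity_of_embedding {U : Type*} [AddCommGroup U] [Module K U]
    (Y : U →ₗ[K] fieldSpace K r U) (ι : U →ₗ[K] fieldSpace K r W) (hι : Function.Injective ι)
    (hloc : ∀ a b, MutuallyLocal (ι a : FormalDist K r W) (ι b))
    (hY : ∀ a b t m, ι (coeff (Y a) t m b) = YE (ι a) (ι b) t m) : JacobiIdentity Y Y := by
  intro a b c l p q m n
  obtain ⟨kab, hab⟩ := (hloc a b).exists_localAt
  obtain ⟨kac, hac⟩ := (hloc a c).exists_localAt
  obtain ⟨kbc, hbc⟩ := (hloc b c).exists_localAt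
  -- `N` bounds the number of nonzero terms in each of the three sums.
  obtain ⟨N, h1, h2, h3⟩ : ∃ N : ℕ, kab ≤ l + N ∧ kac ≤ (-p - 1) + (N : ℤ) ∧
      kbc ≤ (-q - 1) + (N : ℤ) :=
    ⟨(max (kab - l) (max (kac + p + 1) (kbc + q + 1))).toNat, by omega, by omega, by omega⟩
  have hzero : ∀ {x y : U} {k : ℕ},
      (∀ m n, LocalAt k (component (ι x) m) (component (ι y) n)) →
      ∀ (t : ℤ) (m : Fin r → ℤ), t + k < 0 → coeff (Y x) t m y = 0 := fun h t m ht =>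
    hι (by rw [hY, map_zero, YE_eq_zero (compatibleWith_of_localAt h) (by omega)])
  refine hι (fieldSpace_ext fun s k w => ?_)
  let f : U →+ W :=
    { toFun := fun x => coeff (ι x) s k w
      map_zero' := by rw [map_zero]; rfl
      map_add' := fun x y => by rw [map_add]; rfl }
  change f _ = f _
  have ev : ∀ (x y : U) (t : ℤ) (m : Fin r → ℤ), f (coeff (Y x) t m y) =
      resProd (-t - 1) (component (ι x) m) (component (ι y) (k - m)) s w := fun x y t m => by
    change coeff (ι (coeff (Y x) t m y)) s k w = _
    rw [hY, coeff_YE (hloc x y)]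
  rw [map_sub, map_jacobiTerm₁ f l p q m n N _ _ _ fun i hi => hzero hbc _ _ (by omega),
    map_jacobiTerm₂ f l p q m n N _ _ _ fun i hi => hzero hac _ _ (by omega),
    map_jacobiTerm₃ f l p q m n N _ _ _ _ fun i hi => hzero hab _ _ (by omega)]
  simp only [ev, hY]
  -- The coefficient at `x₀^p y₀^q` is the residue after multiplication by `x₀^(-p-1) y₀^(-q-1)`.
  have key := resProd_borcherds (hab m (n - m)) (hac m (k - n)) (hbc (n - m) (k - n)) l (-p - 1)
    (-q - 1) N h1 h2 h3
    (fun i => component (YE (ι a) (ι b) (-l - 1 - i) m) n)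
    (fun i => component (YE (ι a) (ι c) (p - i) m) (k - (n - m)))
    (fun i => component (YE (ι b) (ι c) (q - i) (n - m)) (k - m))
    (fun i s w => by
      rw [fcoeff_component, coeff_YE (hloc a b)]
      congr 1; ring)
    (fun i s w => by
      rw [fcoeff_component, coeff_YE (hloc a c), show k - (n - m) - m = k - n by abel]
      congr 1; ring)
    (fun i s w => by
      rw [fcoeff_component, coeff_YE (hloc b c), show k - m - (n - m) = k - n by abel]
      congr 1; ring) s w
  refine Eq.trans ?_ (key.trans ?_)
  · congr 1
    · refine Finset.sum_congr rfl fun i _ => ?_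
      rw [show -(p - l + i) - 1 = -p - 1 + l - i by ring]
    · congr 1
      refine Finset.sum_congr rfl fun i _ => ?_
      rw [show -(q - l + i) - 1 = -q - 1 + l - i by ring]
  · refine Finset.sum_congr rfl fun i _ => ?_
    rw [show -(q + (p + i) + 1) - 1 = -p - 1 + (-q - 1) - i by ring]

/-! ### The vertex algebra of a closed local subspace -/

theorem IsLocalSubspace.mutuallyLocal {V : Submodule K (fieldSpace K r W)} (h : IsLocalSubspace V)
    (a b : V) : MutuallyLocal ((a : fieldSpace K r W) : FormalDist K r W) (b : fieldSpace K r W) :=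
  h _ ⟨a, a.2, rfl⟩ _ ⟨b, b.2, rfl⟩

theorem IsClosedSubspace.YE_mem {V : Submodule K (fieldSpace K r W)} (h : IsClosedSubspace V)
    (a b : V) (t : ℤ) (m : Fin r → ℤ) : YE (a : fieldSpace K r W) b t m ∈ V := by
  have := h a a.2 b b.2 (-t - 1) (-m)
  rwa [modeProduct, neg_neg, show -(-t - 1) - 1 = t by ring] at this

variable {V : Submodule K (fieldSpace K r W)} (hlocal : IsLocalSubspace V)
  (hclosed : IsClosedSubspace V)

/-- The coefficient of `z₀^t z^m` in `Y_ℰ(a; z₀, z)`, as an operator on a closed local subspace. -/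
def vertexOpCoeff (a : V) (t : ℤ) (m : Fin r → ℤ) : Module.End K V where
  toFun b := ⟨YE (a : fieldSpace K r W) b t m, hclosed.YE_mem a b t m⟩
  map_add' b b' := by
    refine Subtype.ext (fieldSpace_ext fun q n w => ?_)
    change coeff (YE (a : fieldSpace K r W) ((b + b' : V) : fieldSpace K r W) t m) q n w =
      coeff (YE (a : fieldSpace K r W) b t m) q n w + coeff (YE (a : fieldSpace K r W) b' t m) q n w
    rw [coeff_YE (hlocal.mutuallyLocal _ _), coeff_YE (hlocal.mutuallyLocal _ _),
      coeff_YE (hlocal.mutuallyLocal _ _)]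
    refine resProd_add (fun p q => ?_) (fun p q => ?_) _ _
    · exact map_add _ _ _
    · rfl
  map_smul' c b := by
    refine Subtype.ext (fieldSpace_ext fun q n w => ?_)
    change coeff (YE (a : fieldSpace K r W) ((c • b : V) : fieldSpace K r W) t m) q n w =
      c • coeff (YE (a : fieldSpace K r W) b t m) q n w
    rw [coeff_YE (hlocal.mutuallyLocal _ _), coeff_YE (hlocal.mutuallyLocal _ _)]
    refine map_resProd (DistribSMul.toAddMonoidHom W c) (fun p q => ?_) (fun p q => ?_) _ _
    · exact map_smul _ _ _
    · rfl

theorem IsLocalSubspace.exists_YE_eq_zero {V : Submodule K (fieldSpace K r W)}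
    (hlocal : IsLocalSubspace V) (a b : V) :
    ∃ N : ℤ, ∀ t < N, ∀ m, YE (a : fieldSpace K r W) b t m = 0 := by
  obtain ⟨k, hk⟩ := (hlocal.mutuallyLocal a b).exists_localAt
  exact ⟨-k, fun t ht m => YE_eq_zero (compatibleWith_of_localAt hk) (by omega) m⟩

/-- The map `a ↦ Y_ℰ(a; z₀, z)` on a closed local subspace. -/
def vertexOp : V →ₗ[K] fieldSpace K r V where
  toFun a := ⟨vertexOpCoeff hlocal hclosed a, fun b => by
    obtain ⟨N, hN⟩ := hlocal.exists_YE_eq_zero a b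
    exact ⟨N, fun t ht m => Subtype.ext (hN t ht m)⟩⟩
  map_add' a a' := by
    refine fieldSpace_ext fun t m b => Subtype.ext (fieldSpace_ext fun q n w => ?_)
    change coeff (YE ((a + a' : V) : fieldSpace K r W) b t m) q n w =
      coeff (YE (a : fieldSpace K r W) b t m) q n w + coeff (YE (a' : fieldSpace K r W) b t m) q n w
    rw [coeff_YE (hlocal.mutuallyLocal _ _), coeff_YE (hlocal.mutuallyLocal _ _),
      coeff_YE (hlocal.mutuallyLocal _ _)]
    refine resProd_add (fun p q => ?_) (fun p q => ?_) _ _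
    · rfl
    · exact map_add _ _ _
  map_smul' c a := by
    refine fieldSpace_ext fun t m b => Subtype.ext (fieldSpace_ext fun q n w => ?_)
    change coeff (YE ((c • a : V) : fieldSpace K r W) b t m) q n w =
      c • coeff (YE (a : fieldSpace K r W) b t m) q n w
    rw [coeff_YE (hlocal.mutuallyLocal _ _), coeff_YE (hlocal.mutuallyLocal _ _)]
    refine map_resProd (DistribSMul.toAddMonoidHom W c) (fun p q => ?_) (fun p q => ?_) _ _
    · rfl
    · exact map_smul _ _ _

theorem coe_coeff_vertexOp (a b : V) (t : ℤ) (m : Fin r → ℤ) :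
    (coeff (vertexOp hlocal hclosed a) t m b : fieldSpace K r W) =
      YE (a : fieldSpace K r W) b t m := rfl

theorem jacobiIdentity_subtype : JacobiIdentity (vertexOp hlocal hclosed) V.subtype := by
  intro a b w l p q m n
  obtain ⟨k, hk⟩ := (hlocal.mutuallyLocal a b).exists_localAt
  obtain ⟨N, hN⟩ := hlocal.exists_YE_eq_zero a b
  have h3 : jacobiTerm₃ (vertexOp hlocal hclosed) V.subtype a b w l p q m n =
      ∑ i ∈ Finset.range (max (-l - N) (k - l)).toNat, (Ring.choose (-p - 1) i : ℤ) •
        resProd (l + i) (component (a : fieldSpace K r W) m)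
          (component (b : fieldSpace K r W) (n - m)) (q + p + i + 1) w := by
    rw [jacobiTerm₃, finsum_nat_eq_sum_range _ (max (-l - N) (k - l)).toNat]
    · refine Finset.sum_congr rfl fun i _ => ?_
      rw [binomCoeff_delta]
      change _ • coeff (YE (a : fieldSpace K r W) b _ m) _ n w = _
      rw [coeff_YE (hlocal.mutuallyLocal a b)]
      congr 2 <;> ring
    · intro i hi
      change _ • coeff (YE (a : fieldSpace K r W) b _ m) _ n w = _
      rw [hN _ (by omega)]
      exact smul_zero _
  rw [h3, ← expandL_sub_expandR_eq_sum_resProd (hk m (n - m)) l p q _ (by omega) w]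
  rfl

theorem jacobiIdentity_vertexOp :
    JacobiIdentity (vertexOp hlocal hclosed) (vertexOp hlocal hclosed) :=
  jacobiIdentity_of_embedding _ V.subtype Subtype.val_injective hlocal.mutuallyLocal
    fun _ _ _ _ => rfl

/-- The toroidal vertex algebra `(V, Y_ℰ, 1_W)`. -/
def vertexAlgebra (hone : idField K r W ∈ V) : ToroidalVertexAlgebra K r V where
  Y := vertexOp hlocal hclosed
  vac := ⟨idField K r W, hone⟩
  Y_vac := by
    refine fieldSpace_ext fun t m b => Subtype.ext ?_
    rw [coe_coeff_vertexOp, YE_idField_left, coeff_idField]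
    split_ifs <;> rfl
  Y_apply_vac a p m hp := by
    refine Subtype.ext ?_
    rw [coe_coeff_vertexOp]
    exact YE_eq_zero (compatibleWith_idField_right _) (by simpa using hp) m
  jacobi := jacobiIdentity_vertexOp hlocal hclosed

/-- The extended toroidal vertex algebra `(V, Y_ℰ, 1_W, D₀, …, D_r)`. -/
def extendedVertexAlgebra (hone : idField K r W ∈ V) (h0 : ∀ a ∈ V, derivZero K r W a ∈ V)
    (hD : ∀ j : Fin r, ∀ a ∈ V, eulerDeriv K r W j a ∈ V) :
    ExtendedToroidalVertexAlgebra K r V where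
  toToroidalVertexAlgebra := vertexAlgebra hlocal hclosed hone
  D₀ := (derivZero K r W).restrict h0
  D j := (eulerDeriv K r W j).restrict (hD j)
  D₀_vac := Subtype.ext derivZero_idField
  D_vac j := Subtype.ext (eulerDeriv_idField j)
  D₀_comm a t m := LinearMap.ext fun b => Subtype.ext <| sub_eq_of_eq_add <|
    derivZero_YE (hlocal.mutuallyLocal a b) (hlocal.mutuallyLocal ⟨_, h0 a a.2⟩ b)
      (hlocal.mutuallyLocal a ⟨_, h0 b b.2⟩) t m
  Y_D₀ a := fieldSpace_ext fun t m b => Subtype.ext <|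
    YE_derivZero_left (hlocal.mutuallyLocal a b) (hlocal.mutuallyLocal ⟨_, h0 a a.2⟩ b) t m
  D_comm j a t m := LinearMap.ext fun b => Subtype.ext <| sub_eq_of_eq_add <|
    eulerDeriv_YE j (hlocal.mutuallyLocal a b) (hlocal.mutuallyLocal ⟨_, hD j a a.2⟩ b)
      (hlocal.mutuallyLocal a ⟨_, hD j b b.2⟩) t m
  Y_D j a := fieldSpace_ext fun t m b => Subtype.ext <|
    YE_eulerDeriv_left j (hlocal.mutuallyLocal a b) (hlocal.mutuallyLocal ⟨_, hD j a a.2⟩ b) t m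

end Algebra

end Toroidal

end

theorem theorem3p4 {K : Type*} [Field K] [CharZero K] (r : ℕ) (hr : 0 < r)
    {W : Type*} [AddCommGroup W] [Module K W] (V : Submodule K (fieldSpace K r W))
    (hlocal : IsLocalSubspace V) (hclosed : IsClosedSubspace V) (hone : idField K r W ∈ V) :
    ∃ A : ToroidalVertexAlgebra K r V,
      (∀ (a b : V) (t : ℤ) (m : Fin r → ℤ),
        (coeff (A.Y a) t m b : fieldSpace K r W) = YE (a : fieldSpace K r W) b t m) ∧
      A.vac = ⟨idField K r W, hone⟩ ∧
      (∃ M : ToroidalModule W A, (∀ a : V, M.Y a = a) ∧ M.IsFaithful) ∧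
      ((∀ a ∈ V, derivZero K r W a ∈ V) → (∀ j : Fin r, ∀ a ∈ V, eulerDeriv K r W j a ∈ V) →
        ∃ B : ExtendedToroidalVertexAlgebra K r V,
          B.toToroidalVertexAlgebra = A ∧
          (∀ a : V, (B.D₀ a : fieldSpace K r W) = derivZero K r W a) ∧
          ∀ (j : Fin r) (a : V), (B.D j a : fieldSpace K r W) = eulerDeriv K r W j a) := by
  refine ⟨vertexAlgebra hlocal hclosed hone, fun _ _ _ _ => rfl, rfl, ?_, fun h0 hD => ?_⟩
  · exact ⟨⟨V.subtype, rfl, jacobiIdentity_subtype hlocal hclosed⟩, fun _ => rfl,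
      V.injective_subtype⟩
  · exact ⟨extendedVertexAlgebra hlocal hclosed hone h0 hD, rfl, fun _ => rfl, fun _ _ => rfl⟩
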